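/- Let $U$ be an $r$-dimensional real vector space with a fixed basis $s=(s_1,\dots,s_r)$ and dual basis $(t_1,\dots,t_r)$ of $U^*$. Let $du$ be the Lebesgue measure on $U$ in the coordinates $t_i$, and let $X=(x_1,\dots,x_N)$ be a finite ordered list of vectors spanning $U$. Sublists are identified with sets of positions, so repeated vectors count as different elements. *Bases and activity.* $\mathbb B(X)$ is the set of bases $B=(b_1,\dots,b_r)=(x_{i_1},\dots,x_{i_r})$, $i_1<\dots<i_r$, of $U$ selected from $X$; $\det(B)$ is the determinant of the coordinate matrix of $B$ with respect to $s$; and $E(B)$ is the set of $x\in X\setminus B$ that lie in $\mathrm{span}\{b\in B: b\le x\}$, where $\le$ is the order of the list. A cocircuit is an inclusion-minimal sublist of $X$ that meets every $B\in\mathbb B(X)$. *Spaces.* For $u=\sum\lambda_i s_i$ put $p_u=\sum\lambda_i s_i\in\mathbb R[s_1,\dots,s_r]$, and for $Y\subseteq X$ put $p_Y=\prod_{x\in Y}p_x$. For $p\in\mathbb R[s_1,\dots,s_r]$ and $f\in\mathbb R[t_1,\dots,t_r]$ let $\langle p,f\rangle=\bigl(p(\tfrac{\partial}{\partial t_1},\dots,\tfrac{\partial}{\partial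 t_r})f\bigr)(0)$. Let $\mathcal J(X)$ be the ideal of $\mathbb R[s_1,\dots,s_r]$ generated by the $p_T$ with $T$ a cocircuit, $\mathcal D(X)=\{f\in\mathbb R[t_1,\dots,t_r]:\langle q,f\rangle=0\text{ for all }q\in\mathcal J(X)\}$ (the Dahmen–Micchelli space), and $\mathcal P(X)=\mathrm{span}\{p_Y: Y\subseteq X,\ X\setminus Y\text{ spans }U\}$. For $B\in\mathbb B(X)$ let $Q_B=p_{X\setminus(B\cup E(B))}$. *The polynomials $R^B$.* For a finite list $Y=(y_1,\dots,y_n)$ contained in an open half-space $\{\eta>0\}$, $\eta\in U^*$, the multivariate spline $T_Y$ is the distribution $\varphi\mapsto\int_0^\infty\!\cdots\int_0^\infty\varphi(\sum\lambda_i y_i)\,d\lambda_1\cdots d\lambda_n$ (so $T_\emptyset=\delta_0$). For $B\in\mathbb B(X)$ let $Z=X\setminus E(B)$ and $S_i=\mathrm{span}(b_1,\dots,b_i)$. Let $P_i$ (resp. $N_i$) be the sublist of those $u\in Z\cap(S_i\setminus S_{i-1})$ for which the endomorphism of $S_i$ fixing $b_1,\dots,b_{i-1}$ and sending $b_i$ to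 $u$ has positive (resp. negative) determinant. Put $$R^B_i=(-1)^{|N_i|}\,T_{P_i}*T_{-N_i}-(-1)^{|P_i|}\,T_{-P_i}*T_{N_i},\qquad R^B_{X\setminus E(B)}=R^B_1*\cdots*R^B_r ,$$ where $*$ denotes convolution of distributions and the empty convolution is $\delta_0$. **Theorem.** For every $B\in\mathbb B(X)$ these convolutions are defined, and there is a unique polynomial in $\mathbb R[t_1,\dots,t_r]$, again denoted $R^B_{X\setminus E(B)}$, such that the distribution $R^B_{X\setminus E(B)}$ is $\varphi\mapsto\int_U R^B_{X\setminus E(B)}(u)\varphi(u)\,du$. The family $\bigl(|\det(B)|\,R^B_{X\setminus E(B)}\bigr)_{B\in\mathbb B(X)}$ is a basis of $\mathcal D(X)$, the family $(Q_B)_{B\in\mathbb B(X)}$ is a basis of $\mathcal P(X)$, and these bases are dual under the pairing: for all $B,D\in\mathbb B(X)$, $$\bigl\langle Q_B,\ |\det(D)|\,R^D_{X\setminus E(D)}\bigr\rangle=\delta_{B,D}.$$ -/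

import Mathlib

open MvPolynomial
open scoped Distributions Pointwise Topology

namespace ZonotopalAlgebra

/-! ## Distributions on a real vector space -/

section Distributions

variable {U : Type*} [NormedAddCommGroup U] [NormedSpace ℝ U]

/-- Test functions on `U`: compactly supported smooth functions `U → ℝ`. -/
abbrev Test (U : Type*) [NormedAddCommGroup U] [NormedSpace ℝ U] : Type _ :=
  𝓓((⊤ : TopologicalSpace.Opens U), ℝ)

/-- Distributions on `U`: continuous linear functionals on the space of test functions. -/
abbrev Distr (U : Type*) [NormedAddCommGroup U] [NormedSpace ℝ U] : Type _ :=
  𝓓'((⊤ : TopologicalSpace.Opens U), ℝ)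

/-- The test function `η ↦ φ (ξ + η)`. -/
noncomputable def translate (ξ : U) (φ : Test U) : Test U where
  toFun η := φ (ξ + η)
  contDiff' := φ.contDiff.comp (contDiff_const.add contDiff_id)
  hasCompactSupport' := φ.hasCompactSupport.comp_homeomorph (Homeomorph.addLeft ξ)
  tsupport_subset' := fun _ _ => trivial

/-- `R` is the convolution `S * T` of the distributions `S` and `T`:
* `supp S ∩ (K - supp T)` is compact for every compact set `K`, and
* `R φ = S_ξ (T_η (α ξ * φ (ξ + η)))` for every test function `φ`, where `α` is any test function
  that is equal to one on a neighbourhood of `supp S ∩ (supp φ - supp T)`; in particular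
  `ξ ↦ T_η (α ξ * φ (ξ + η))` is a test function. -/
def IsConvolution (S T R : Distr U) : Prop :=
  (∀ K : Set U, IsCompact K →
    IsCompact (Distribution.dsupport S ∩ (K - Distribution.dsupport T))) ∧
  ∀ φ α : Test U,
    (∀ᶠ ξ in 𝓝ˢ (Distribution.dsupport S ∩ (tsupport φ - Distribution.dsupport T)), α ξ = 1) →
    ∃ ψ : Test U, (∀ ξ, ψ ξ = T (α ξ • translate ξ φ)) ∧ R φ = S ψ

/-- `T` is the multivariate spline (truncated power) `T_Y` of the finite list `Y` of vectors:
`T φ = ∫_0^∞ ⋯ ∫_0^∞ φ (∑ i, c i • Y i) dc` (where the integral converges) for every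
test function `φ`. For the empty list this is the delta distribution at the origin. -/
def IsSpline {ι : Type*} [Fintype ι] (Y : ι → U) (T : Distr U) : Prop :=
  ∀ φ : Test U,
    MeasureTheory.IntegrableOn (fun c : ι → ℝ => φ (∑ i, c i • Y i)) {c | ∀ i, 0 ≤ c i} ∧
    T φ = ∫ c in {c : ι → ℝ | ∀ i, 0 ≤ c i}, φ (∑ i, c i • Y i)

/-- The function on `U` given by a polynomial in the coordinates `t₁, …, t_r` with respect
to the basis `s = (s₁, …, s_r)` of `U`. -/
noncomputable def polyFun {r : ℕ} (s : Module.Basis (Fin r) ℝ U) (f : MvPolynomial (Fin r) ℝ)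
    (u : U) : ℝ :=
  eval (fun i => s.repr u i) f

/-- The distribution `φ ↦ ∫ f(u) φ(u) du` defined by a polynomial `f`, where `du` is the
Lebesgue measure for which the parallelepiped spanned by the basis `s` has volume one. -/
noncomputable def polyDistr [MeasurableSpace U] [BorelSpace U] {r : ℕ}
    (s : Module.Basis (Fin r) ℝ U) (f : MvPolynomial (Fin r) ℝ) : Distr U :=
  (TestFunction.integralAgainstBilinCLM (ContinuousLinearMap.mul ℝ ℝ) s.addHaar (polyFun s f) :
    Test U →L[ℝ] ℝ)

theorem polyDistr_apply [MeasurableSpace U] [BorelSpace U] {r : ℕ}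
    (s : Module.Basis (Fin r) ℝ U) (f : MvPolynomial (Fin r) ℝ) (φ : Test U) :
    polyDistr s f φ = ∫ u, φ u * polyFun s f u ∂s.addHaar := by
  have : FiniteDimensional ℝ U := s.finiteDimensional_of_finite
  have hc : Continuous (polyFun s f) := by
    unfold polyFun
    refine (MvPolynomial.continuous_eval f).comp (continuous_pi fun i => ?_)
    exact (s.coord i).continuous_of_finiteDimensional
  have h := TestFunction.integralAgainstBilinCLM_eq_integral (n := ⊤)
    (Ω := (⊤ : TopologicalSpace.Opens U)) (B := ContinuousLinearMap.mul ℝ ℝ)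
    (μ := s.addHaar) (f := φ) (hc.locallyIntegrable.locallyIntegrableOn _)
  exact h

end Distributions

/-! ## Ordered lists of vectors and their bases -/

section Lists

variable {U : Type*} [AddCommGroup U] [Module ℝ U] {N r : ℕ}

/-- A basis `B = (x_{i₁}, …, x_{i_r})`, `i₁ < ⋯ < i_r`, of `U` selected from the list
`X = (x₁, …, x_N)`, given by its increasing sequence of positions. The type of all of them
is `𝔹(X)`. -/
structure ListBasis (r : ℕ) (X : Fin N → U) where
  idx : Fin r ↪o Fin N
  linInd : LinearIndependent ℝ fun i => X (idx i)
  span_eq : Submodule.span ℝ (Set.range fun i => X (idx i)) = ⊤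

/-- The vectors `(b₁, …, b_r)` of a basis selected from `X`. -/
def ListBasis.vec {X : Fin N → U} (B : ListBasis r X) (i : Fin r) : U := X (B.idx i)

/-- The sublist `B` of `X`, as a set of positions. -/
def ListBasis.support {X : Fin N → U} (B : ListBasis r X) : Finset (Fin N) :=
  Finset.univ.map B.idx.toEmbedding

open Classical in
/-- `E(B)`: the externally active elements `x ∈ X ∖ B`, `x ∈ clos {b ∈ B : b ≤ x}`. -/
noncomputable def ListBasis.extActive {X : Fin N → U} (B : ListBasis r X) : Finset (Fin N) :=
  {e | e ∉ B.support ∧ X e ∈ Submodule.span ℝ {u | ∃ j : Fin r, B.idx j ≤ e ∧ u = B.vec j}}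

/-- `C` meets every basis that can be selected from `X`. -/
def MeetsBases (r : ℕ) (X : Fin N → U) (C : Finset (Fin N)) : Prop :=
  ∀ B : ListBasis r X, (C ∩ B.support).Nonempty

/-- Cocircuits: minimal sublists that meet all bases. -/
def IsCocircuit (r : ℕ) (X : Fin N → U) (C : Finset (Fin N)) : Prop :=
  Minimal (MeetsBases r X) C

/-- The flag `S_k = span {b₁, …, b_k}`. -/
def ListBasis.flag {X : Fin N → U} (B : ListBasis r X) (k : ℕ) : Submodule ℝ U :=
  Submodule.span ℝ {u | ∃ j : Fin r, (j : ℕ) < k ∧ u = B.vec j}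

/-- `u ∈ S_{k+1}` is positive: the endomorphism of `S_{k+1}` that fixes `b₁, …, b_k` and sends
`b_{k+1}` to `u` has positive determinant (here `i = k` is the 0-based index of `b_{k+1}`). -/
def ListBasis.IsPositive {X : Fin N → U} (B : ListBasis r X) (i : Fin r) (u : U) : Prop :=
  ∃ g : B.flag (i + 1) →ₗ[ℝ] B.flag (i + 1),
    (∀ v : B.flag (i + 1), (∀ j < i, (v : U) = B.vec j → g v = v) ∧
      ((v : U) = B.vec i → (g v : U) = u)) ∧
    0 < LinearMap.det g

open Classical in
/-- `P_{i}`: the positive elements of `Z ∩ (S_i ∖ S_{i-1})`. -/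
noncomputable def ListBasis.pos {X : Fin N → U} (B : ListBasis r X) (Z : Finset (Fin N))
    (i : Fin r) : Finset (Fin N) :=
  {e ∈ Z | X e ∈ B.flag (i + 1) ∧ X e ∉ B.flag i ∧ B.IsPositive i (X e)}

open Classical in
/-- `N_{i}`: the negative elements of `Z ∩ (S_i ∖ S_{i-1})`. -/
noncomputable def ListBasis.neg {X : Fin N → U} (B : ListBasis r X) (Z : Finset (Fin N))
    (i : Fin r) : Finset (Fin N) :=
  {e ∈ Z | X e ∈ B.flag (i + 1) ∧ X e ∉ B.flag i ∧ ¬ B.IsPositive i (X e)}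

end Lists

/-! ## The distributions `R^B_Z` -/

section BasisDistribution

variable {U : Type*} [NormedAddCommGroup U] [NormedSpace ℝ U] {N r : ℕ}

/-- `T = T_Y * T_{Y'}`, the convolution of two multivariate splines. -/
def IsSplineConv {ι κ : Type*} [Fintype ι] [Fintype κ] (Y : ι → U) (Y' : κ → U) (T : Distr U) :
    Prop :=
  ∃ A A' : Distr U, IsSpline Y A ∧ IsSpline Y' A' ∧ IsConvolution A A' T

/-- `T = R_i^B = T_i^{B+} - T_i^{B-}`, where
`T_i^{B+} = (-1)^{|N_i|} T_{P_i} * T_{-N_i}` and `T_i^{B-} = (-1)^{|P_i|} T_{-P_i} * T_{N_i}`. -/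
def IsFactor (X : Fin N → U) (Z : Finset (Fin N)) (B : ListBasis r X) (i : Fin r)
    (T : Distr U) : Prop :=
  ∃ A A' : Distr U,
    IsSplineConv (fun e : B.pos Z i => X e) (fun e : B.neg Z i => -X e) A ∧
    IsSplineConv (fun e : B.pos Z i => -X e) (fun e : B.neg Z i => X e) A' ∧
    T = (-1 : ℝ) ^ (B.neg Z i).card • A - (-1 : ℝ) ^ (B.pos Z i).card • A'

/-- `R = R^B_Z = R_1^B * ⋯ * R_r^B`: the last term of a sequence of distributions
`C_0 = δ_0`, `C_i = C_{i-1} * R_i^B`. -/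
def IsBasisDistr (X : Fin N → U) (Z : Finset (Fin N)) (B : ListBasis r X) (R : Distr U) : Prop :=
  ∃ C : Fin (r + 1) → Distr U, C 0 = Distribution.delta 0 ∧
    (∀ i : Fin r, ∃ F : Distr U, IsFactor X Z B i F ∧ IsConvolution (C i.castSucc) F (C i.succ)) ∧
    R = C (Fin.last r)

end BasisDistribution

/-! ## The pairing and the central zonotopal spaces -/

section Spaces

variable {U : Type*} [AddCommGroup U] [Module ℝ U] {N r : ℕ}

/-- The constant-coefficient differential operator `∏ i, (∂/∂t_i)^(m i)` on `ℝ[t₁, …, t_r]`. -/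
noncomputable def monomialDiffOp (m : Fin r →₀ ℕ) :
    Module.End ℝ (MvPolynomial (Fin r) ℝ) :=
  ((List.finRange r).map fun i =>
    ((pderiv i : Derivation ℝ (MvPolynomial (Fin r) ℝ) (MvPolynomial (Fin r) ℝ)).toLinearMap :
      Module.End ℝ (MvPolynomial (Fin r) ℝ)) ^ m i).prod

/-- The differential operator `p(∂/∂t₁, …, ∂/∂t_r)`. -/
noncomputable def diffOp (p : MvPolynomial (Fin r) ℝ) :
    Module.End ℝ (MvPolynomial (Fin r) ℝ) :=
  ∑ m ∈ p.support, p.coeff m • monomialDiffOp m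

/-- The pairing `⟨p, f⟩ = (p(∂/∂t₁, …, ∂/∂t_r) f)(0)`. -/
noncomputable def pairing (p f : MvPolynomial (Fin r) ℝ) : ℝ :=
  constantCoeff (diffOp p f)

/-- The kernel (Macaulay inverse system) of an ideal. -/
noncomputable def inverseSystem (I : Ideal (MvPolynomial (Fin r) ℝ)) :
    Submodule ℝ (MvPolynomial (Fin r) ℝ) where
  carrier := {f | ∀ q ∈ I, pairing q f = 0}
  add_mem' := by
    intro f g hf hg q hq
    have h1 := hf q hq
    have h2 := hg q hq
    simp only [pairing] at h1 h2 ⊢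
    rw [map_add, map_add, h1, h2, add_zero]
  zero_mem' := by
    intro q _
    simp [pairing]
  smul_mem' := by
    intro c f hf q hq
    have h1 := hf q hq
    simp only [pairing] at h1 ⊢
    rw [map_smul, constantCoeff_smul, h1, smul_zero]

/-- The linear form `p_u = ∑ i, λ_i s_i` of a vector `u = ∑ i, λ_i s_i`. -/
noncomputable def linForm (s : Module.Basis (Fin r) ℝ U) (u : U) : MvPolynomial (Fin r) ℝ :=
  ∑ i, C (s.repr u i) * MvPolynomial.X i

/-- `p_Y = ∏_{x ∈ Y} p_x` for a sublist `Y` of `X`. -/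
noncomputable def prodForm (s : Module.Basis (Fin r) ℝ U) (X : Fin N → U) (Y : Finset (Fin N)) :
    MvPolynomial (Fin r) ℝ :=
  ∏ e ∈ Y, linForm s (X e)

/-- The ideal `J(X)` generated by the products `p_T` over the cocircuits `T` of `X`. -/
noncomputable def cocircuitIdeal (s : Module.Basis (Fin r) ℝ U) (X : Fin N → U) :
    Ideal (MvPolynomial (Fin r) ℝ) :=
  Ideal.span {p | ∃ T, IsCocircuit r X T ∧ p = prodForm s X T}

/-- The Dahmen–Micchelli space `D(X) = ker J(X)`. -/
noncomputable def spaceD (s : Module.Basis (Fin r) ℝ U) (X : Fin N → U) :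
    Submodule ℝ (MvPolynomial (Fin r) ℝ) :=
  inverseSystem (cocircuitIdeal s X)

/-- The central space `P(X)`, spanned by the `p_Y` with `X ∖ Y` of full rank. -/
noncomputable def spaceP (s : Module.Basis (Fin r) ℝ U) (X : Fin N → U) :
    Submodule ℝ (MvPolynomial (Fin r) ℝ) :=
  Submodule.span ℝ {p | ∃ Y : Finset (Fin N),
    Submodule.span ℝ {u | ∃ e ∉ Y, u = X e} = ⊤ ∧ p = prodForm s X Y}

/-- `Q_B = p_{X ∖ (B ∪ E(B))}`. -/
noncomputable def polyQ (s : Module.Basis (Fin r) ℝ U) (X : Fin N → U) (B : ListBasis r X) :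
    MvPolynomial (Fin r) ℝ :=
  prodForm s X (B.support ∪ B.extActive)ᶜ

end Spaces

end ZonotopalAlgebra

namespace ZonotopalAlgebra

/-! ### Constant-coefficient differential operators -/

section DiffOp

variable {r : ℕ}

/-! Fix a basis `D = (d_1, …, d_r)` selected from `X`. The elements outside `E(D)` split into levels
according to their last nonzero `D`-coordinate, and level `k` contains `d_k`. For `y` in level `k`,
let `I_y` send a homogeneous `g` to the polynomial `h` with `∂_y h = g` that vanishes where the
`k`-th coordinate is zero. Starting from `1` and applying `I_y`, level after level, for every `y`
other than the `d_k` yields a homogeneous polynomial `dualPoly` of degree `|X ∖ (D ∪ E(D))|`.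
Everything rests on two descriptions of it.

Analytically it is `|det D| R^D`. Take a polynomial density on `S_{k-1}`. Convolution with the ray
of `d_k` spreads it constantly over half of `S_k`, and each further ray `±y` integrates along `y`,
which is `±I_y`. Both half-spaces produce the same polynomial, with signs `(-1)^{|N_k|}` and
`-(-1)^{|P_k|}`; the coefficients in `R_k` cancel these, and the halves glue to one polynomial
density on `S_k` (`isConvolution_partialDistr`). The factor `|det D|` is the Jacobian between
`D`-coordinates and `du` (`partialDistr_last`).

Algebraically, `p_A(∂)` commutes with `∂_y`, and if `A` lies in the hyperplane used by `I_y` then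
`p_A(∂)` annihilates `I_y g` as soon as it annihilates `g`. Therefore the product of a whole level
annihilates `dualPoly` (`diffOp_level_partialPoly`). Every cocircuit contains a level of `D`
(`exists_level_subset`), so `dualPoly` lies in `D(X)`. `Q_D(∂)` undoes all the primitives and leaves
`1`. For `B ≠ D`, either `Q_B` contains a level of `D` and annihilates, or `D ∪ E(D)` is strictly
contained in `B ∪ E(B)` (`clos_subset_of_level`) and the degree of `Q_B` is too small; the pairing
is zero in both cases.

Duality gives independence of both families. An exchange argument shows that the `Q_B` span `P(X)`
(`spaceP_le_span_polyQ`). Since `P(X) + J(X)` is the whole ring (`spaceP_sup_cocircuitIdeal`), an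
element of `D(X)` is determined by its pairings with the `Q_B`, so the dual polynomials span `D(X)`.
-/

theorem pderiv_comm (i j : Fin r) (f : MvPolynomial (Fin r) ℝ) :
    pderiv i (pderiv j f) = pderiv j (pderiv i f) := by
  have h : ⁅(pderiv i : Derivation ℝ (MvPolynomial (Fin r) ℝ) (MvPolynomial (Fin r) ℝ)),
      (pderiv j : Derivation ℝ (MvPolynomial (Fin r) ℝ) (MvPolynomial (Fin r) ℝ))⁆ = 0 := by
    refine MvPolynomial.derivation_ext fun k => ?_
    rw [Derivation.commutator_apply]
    simp [pderiv_X, Pi.single_apply, apply_ite]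
  have := congrArg (fun d => d f) h
  rw [Derivation.commutator_apply] at this
  simpa [sub_eq_zero] using this

/-- The partial derivatives as endomorphisms of the polynomial ring. -/
noncomputable def partialEnd (i : Fin r) : Module.End ℝ (MvPolynomial (Fin r) ℝ) :=
  (pderiv i : Derivation ℝ (MvPolynomial (Fin r) ℝ) (MvPolynomial (Fin r) ℝ)).toLinearMap

theorem partialEnd_comm : ∀ a ∈ Set.range (partialEnd (r := r)),
    ∀ b ∈ Set.range (partialEnd (r := r)), a * b = b * a := by
  rintro _ ⟨i, rfl⟩ _ ⟨j, rfl⟩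
  ext1 f
  exact LinearMap.ext fun g => pderiv_comm i j _

-- `aeval` needs a commutative target, so the variables are evaluated in the subalgebra generated by
-- the partial derivatives, which is commutative although `Module.End` is not.
open scoped IsMulCommutative in
theorem exists_diffOp_algHom : ∃ Φ : MvPolynomial (Fin r) ℝ →ₐ[ℝ]
    Module.End ℝ (MvPolynomial (Fin r) ℝ), (∀ p, Φ p = diffOp p) ∧
      ∀ i, Φ (X i) = partialEnd i := by
  let A := Algebra.adjoin ℝ (Set.range (partialEnd (r := r)))
  have : IsMulCommutative A := Algebra.isMulCommutative_adjoin ℝ (partialEnd_comm (r := r))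
  let x : Fin r → A := fun i => ⟨partialEnd i, Algebra.subset_adjoin ⟨i, rfl⟩⟩
  refine ⟨A.val.comp (aeval x), fun p => ?_, fun i => by
    simp only [AlgHom.comp_apply, aeval_X]; rfl⟩
  change A.val (aeval x p) = _
  rw [aeval_def, eval₂_eq', map_sum]
  unfold diffOp
  refine Finset.sum_congr rfl fun m _ => ?_
  rw [map_mul, Fin.prod_univ_def, map_list_prod, List.map_map, AlgHom.commutes,
    Algebra.algebraMap_eq_smul_one, smul_mul_assoc, one_mul]
  rfl

/-- The algebra homomorphism `p ↦ p(∂/∂t₁, …, ∂/∂t_r)`. -/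
noncomputable def diffOpHom : MvPolynomial (Fin r) ℝ →ₐ[ℝ]
    Module.End ℝ (MvPolynomial (Fin r) ℝ) := exists_diffOp_algHom.choose

theorem diffOpHom_apply (p : MvPolynomial (Fin r) ℝ) : diffOpHom p = diffOp p :=
  exists_diffOp_algHom.choose_spec.1 p

theorem diffOp_mul (p q f : MvPolynomial (Fin r) ℝ) :
    diffOp (p * q) f = diffOp p (diffOp q f) := by
  simp only [← diffOpHom_apply, map_mul, Module.End.mul_apply]

theorem diffOp_one (f : MvPolynomial (Fin r) ℝ) : diffOp 1 f = f := by
  simp only [← diffOpHom_apply, map_one, Module.End.one_apply]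

theorem diffOp_add (p q f : MvPolynomial (Fin r) ℝ) :
    diffOp (p + q) f = diffOp p f + diffOp q f := by
  simp only [← diffOpHom_apply, map_add, LinearMap.add_apply]

theorem diffOp_smul (c : ℝ) (p f : MvPolynomial (Fin r) ℝ) :
    diffOp (c • p) f = c • diffOp p f := by
  simp only [← diffOpHom_apply, map_smul, LinearMap.smul_apply]

theorem diffOp_X (i : Fin r) (f : MvPolynomial (Fin r) ℝ) : diffOp (X i) f = pderiv i f := by
  rw [← diffOpHom_apply, diffOpHom, exists_diffOp_algHom.choose_spec.2]
  rfl

end DiffOp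

/-! ### Directional derivatives of polynomials -/

section DirectionalDerivative

variable {U : Type*} [NormedAddCommGroup U] [NormedSpace ℝ U] {r : ℕ}
  (s : Module.Basis (Fin r) ℝ U)

/-- The directional derivative of a polynomial in the coordinates with respect to `s`. -/
noncomputable def dirDeriv (u : U) :
    Derivation ℝ (MvPolynomial (Fin r) ℝ) (MvPolynomial (Fin r) ℝ) :=
  ∑ i, s.repr u i • pderiv i

theorem dirDeriv_apply (u : U) (f : MvPolynomial (Fin r) ℝ) :
    dirDeriv s u f = ∑ i, s.repr u i • pderiv i f := by
  unfold dirDeriv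
  rw [← Derivation.coeFnAddMonoidHom_apply, map_sum, Finset.sum_apply]
  rfl

theorem diffOp_linForm (u : U) (f : MvPolynomial (Fin r) ℝ) :
    diffOp (linForm s u) f = dirDeriv s u f := by
  rw [dirDeriv_apply, ← diffOpHom_apply, linForm, map_sum, LinearMap.sum_apply]
  refine Finset.sum_congr rfl fun i _ => ?_
  rw [← smul_eq_C_mul, map_smul, LinearMap.smul_apply, diffOpHom_apply, diffOp_X]

theorem dirDeriv_X (u : U) (i : Fin r) : dirDeriv s u (X i) = C (s.repr u i) := by
  rw [dirDeriv_apply, Finset.sum_eq_single i]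
  · simp [smul_eq_C_mul]
  · intro j _ hj; rw [pderiv_X_of_ne hj.symm, smul_zero]
  · simp

theorem dirDeriv_neg (u : U) (f : MvPolynomial (Fin r) ℝ) :
    dirDeriv s (-u) f = -dirDeriv s u f := by
  simp [dirDeriv_apply]

theorem isHomogeneous_dirDeriv {n : ℕ} {f : MvPolynomial (Fin r) ℝ} (hf : f.IsHomogeneous n)
    (u : U) : (dirDeriv s u f).IsHomogeneous (n - 1) := by
  rw [dirDeriv_apply]
  exact IsHomogeneous.sum _ _ _ fun i _ => (homogeneousSubmodule _ _ _).smul_mem _ hf.pderiv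

theorem isHomogeneous_dirDeriv_iterate {n : ℕ} {f : MvPolynomial (Fin r) ℝ}
    (hf : f.IsHomogeneous n) (u : U) (k : ℕ) :
    ((dirDeriv s u)^[k] f).IsHomogeneous (n - k) := by
  induction k with
  | zero => exact hf
  | succ k ih =>
    rw [Function.iterate_succ_apply']
    exact isHomogeneous_dirDeriv s ih u

theorem dirDeriv_eq_zero_of_isHomogeneous_zero {f : MvPolynomial (Fin r) ℝ}
    (hf : f.IsHomogeneous 0) (u : U) : dirDeriv s u f = 0 := by
  rw [← totalDegree_zero_iff_isHomogeneous, totalDegree_eq_zero_iff_eq_C] at hf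
  rw [hf, ← algebraMap_eq, Derivation.map_algebraMap]

theorem dirDeriv_iterate_eq_zero {n : ℕ} {f : MvPolynomial (Fin r) ℝ}
    (hf : f.IsHomogeneous n) (u : U) : (dirDeriv s u)^[n + 1] f = 0 := by
  rw [Function.iterate_succ_apply']
  apply dirDeriv_eq_zero_of_isHomogeneous_zero
  simpa using isHomogeneous_dirDeriv_iterate s hf u n

theorem polyFun_add (f g : MvPolynomial (Fin r) ℝ) (u : U) :
    polyFun s (f + g) u = polyFun s f u + polyFun s g u := map_add _ _ _

theorem polyFun_mul (f g : MvPolynomial (Fin r) ℝ) (u : U) :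
    polyFun s (f * g) u = polyFun s f u * polyFun s g u := map_mul _ _ _

theorem polyFun_neg (f : MvPolynomial (Fin r) ℝ) (u : U) :
    polyFun s (-f) u = -polyFun s f u := map_neg _ _

theorem polyFun_smul (c : ℝ) (f : MvPolynomial (Fin r) ℝ) (u : U) :
    polyFun s (c • f) u = c * polyFun s f u := smul_eval _ _ _

theorem polyFun_zero_poly (u : U) : polyFun s 0 u = 0 := map_zero _

theorem polyFun_one (u : U) : polyFun s 1 u = 1 := map_one _

theorem polyFun_injective {f g : MvPolynomial (Fin r) ℝ} (h : ∀ u, polyFun s f u = polyFun s g u) :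
    f = g := by
  refine MvPolynomial.funext fun x => ?_
  have := h (s.equivFun.symm x)
  unfold polyFun at this
  have hx : (fun i => s.repr (s.equivFun.symm x) i) = x := s.equivFun.apply_symm_apply x
  rwa [hx] at this

theorem continuous_polyFun (f : MvPolynomial (Fin r) ℝ) : Continuous (polyFun s f) := by
  have : FiniteDimensional ℝ U := s.finiteDimensional_of_finite
  unfold polyFun
  refine (MvPolynomial.continuous_eval f).comp (continuous_pi fun i => ?_)
  exact (s.coord i).continuous_of_finiteDimensional

theorem hasDerivAt_polyFun (f : MvPolynomial (Fin r) ℝ) (u v : U) (t : ℝ) :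
    HasDerivAt (fun t : ℝ => polyFun s f (u + t • v)) (polyFun s (dirDeriv s v f) (u + t • v)) t := by
  induction f using MvPolynomial.induction_on with
  | C a =>
    rw [← algebraMap_eq, Derivation.map_algebraMap, polyFun_zero_poly]
    simp only [polyFun, algebraMap_eq, eval_C]
    exact hasDerivAt_const _ _
  | add p q hp hq =>
    simp only [map_add, polyFun_add]
    exact hp.add hq
  | mul_X p i hp =>
    rw [Derivation.leibniz, dirDeriv_X]
    simp only [polyFun_mul, polyFun_add, smul_eq_mul]
    have hX : HasDerivAt (fun t : ℝ => polyFun s (X i) (u + t • v)) (s.repr v i) t := by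
      simp only [polyFun, eval_X, map_add, map_smul, Finsupp.add_apply, Finsupp.smul_apply,
        smul_eq_mul]
      simpa using ((hasDerivAt_id t).mul_const (s.repr v i)).const_add (s.repr u i)
    refine (hp.mul hX).congr_deriv ?_
    simp only [polyFun, eval_C]
    ring

end DirectionalDerivative

/-! ### Primitives vanishing on a hyperplane -/

section Primitive

variable {U : Type*} [NormedAddCommGroup U] [NormedSpace ℝ U] {r : ℕ}
  (s : Module.Basis (Fin r) ℝ U) (η : U →ₗ[ℝ] ℝ)

/-- The polynomial function `f` vanishes on the hyperplane `η = 0`. -/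
def VanishesOnKer (f : MvPolynomial (Fin r) ℝ) : Prop := ∀ u, η u = 0 → polyFun s f u = 0

variable {s η}

theorem VanishesOnKer.dirDeriv {f : MvPolynomial (Fin r) ℝ} (hf : VanishesOnKer s η f) {v : U}
    (hv : η v = 0) : VanishesOnKer s η (dirDeriv s v f) := by
  intro u hu
  have h1 := hasDerivAt_polyFun s f u v 0
  have h2 : (fun t : ℝ => polyFun s f (u + t • v)) = fun _ => 0 := by
    ext t; exact hf _ (by simp [hu, hv])
  rw [h2] at h1
  simpa using h1.unique (hasDerivAt_const _ _)

/-- Such an `f` is constant along `y`, and every line in direction `y` meets the hyperplane. This is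
the uniqueness of primitives. -/
theorem VanishesOnKer.eq_zero {f : MvPolynomial (Fin r) ℝ} (hf : VanishesOnKer s η f) {y : U}
    (hy : η y ≠ 0) (h : ZonotopalAlgebra.dirDeriv s y f = 0) : f = 0 := by
  refine polyFun_injective s fun u => ?_
  rw [polyFun_zero_poly]
  have hd : ∀ t, HasDerivAt (fun t : ℝ => polyFun s f (u + t • y)) 0 t := fun t => by
    simpa [h, polyFun_zero_poly] using hasDerivAt_polyFun s f u y t
  have := is_const_of_deriv_eq_zero (fun t => (hd t).differentiableAt) (fun t => (hd t).deriv)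
    0 (-(η u / η y))
  simp only [zero_smul, add_zero] at this
  rw [this]
  exact hf _ (by simp [hy])

variable (s η)

/-- The linear polynomial with polynomial function `η`. -/
noncomputable def dualForm : MvPolynomial (Fin r) ℝ := ∑ i, C (η (s i)) * X i

theorem polyFun_dualForm (u : U) : polyFun s (dualForm s η) u = η u := by
  conv_rhs => rw [← s.sum_repr u]
  rw [map_sum]
  simp [polyFun, dualForm, mul_comm]

theorem dirDeriv_dualForm (y : U) : dirDeriv s y (dualForm s η) = C (η y) := by
  conv_rhs => rw [← s.sum_repr y]
  simp only [dualForm, map_sum, Derivation.leibniz, dirDeriv_X, map_smul]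
  refine Finset.sum_congr rfl fun i _ => ?_
  rw [← algebraMap_eq, Derivation.map_algebraMap]
  simp [mul_comm]

theorem isHomogeneous_dualForm : (dualForm s η).IsHomogeneous 1 :=
  IsHomogeneous.sum _ _ _ fun i _ => by
    simpa using (isHomogeneous_C _ _).mul (isHomogeneous_X ℝ i)

/-- A polynomial `h` with `∂_y h = g` that vanishes on the hyperplane `η = 0` (if `η y ≠ 0` and
`g` is homogeneous). -/
noncomputable def primitive (y : U) (g : MvPolynomial (Fin r) ℝ) : MvPolynomial (Fin r) ℝ :=
  ∑ k ∈ Finset.range (g.totalDegree + 1), ((-1) ^ k / (k + 1).factorial : ℝ) •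
    (((η y)⁻¹ • dualForm s η) ^ (k + 1) * (dirDeriv s y)^[k] g)

variable {s η}

theorem isHomogeneous_primitive {n : ℕ} {g : MvPolynomial (Fin r) ℝ} (hg : g.IsHomogeneous n)
    (y : U) : (primitive s η y g).IsHomogeneous (n + 1) := by
  by_cases h0 : g = 0
  · subst h0; simp [primitive, isHomogeneous_zero]
  refine IsHomogeneous.sum _ _ _ fun k hk => (homogeneousSubmodule _ _ _).smul_mem _ ?_
  rw [hg.totalDegree h0, Finset.mem_range] at hk
  have h1 : (((η y)⁻¹ • dualForm s η) ^ (k + 1)).IsHomogeneous (k + 1) := by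
    simpa using IsHomogeneous.pow ((homogeneousSubmodule _ _ _).smul_mem _
      (isHomogeneous_dualForm s η)) (k + 1)
  have := h1.mul (isHomogeneous_dirDeriv_iterate s hg y k)
  rwa [show k + 1 + (n - k) = n + 1 by omega] at this

theorem vanishesOnKer_primitive (y : U) (g : MvPolynomial (Fin r) ℝ) :
    VanishesOnKer s η (primitive s η y g) := by
  intro u hu
  rw [primitive, polyFun, map_sum]
  refine Finset.sum_eq_zero fun k _ => ?_
  change polyFun s _ u = 0
  rw [polyFun_smul, polyFun_mul, pow_succ, polyFun_mul, polyFun_smul, polyFun_dualForm, hu]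
  simp

/-- With `τ = η / η(y)`, the sum defining `primitive` is the Taylor expansion of `∫_0^{τ(u)} g(u - c
y) dc`. Since `∂_y τ = 1`, its derivative telescopes to `g`, the last term being a derivative of `g`
of order above its degree. -/
theorem dirDeriv_primitive {n : ℕ} {g : MvPolynomial (Fin r) ℝ} (hg : g.IsHomogeneous n)
    {y : U} (hy : η y ≠ 0) : dirDeriv s y (primitive s η y g) = g := by
  by_cases h0 : g = 0
  · subst h0; simp [primitive]
  have hτ : dirDeriv s y ((η y)⁻¹ • dualForm s η) = 1 := by
    rw [Derivation.map_smul, dirDeriv_dualForm, smul_eq_C_mul, ← C_mul, inv_mul_cancel₀ hy, C_1]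
  set τ := (η y)⁻¹ • dualForm s η with hτdef
  let a : ℕ → MvPolynomial (Fin r) ℝ := fun k =>
    ((-1) ^ k / k.factorial : ℝ) • (τ ^ k * (dirDeriv s y)^[k] g)
  have key : ∀ k, dirDeriv s y (((-1) ^ k / (k + 1).factorial : ℝ) •
      (τ ^ (k + 1) * (dirDeriv s y)^[k] g)) = a k - a (k + 1) := by
    intro k
    simp only [a]
    rw [Derivation.map_smul, Derivation.leibniz, Derivation.leibniz_pow, hτ,
      ← Function.iterate_succ_apply' (dirDeriv s y)]
    have hf : (((k + 1).factorial : ℕ) : ℝ) = (k + 1) * k.factorial := by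
      push_cast [Nat.factorial_succ]; ring
    have hk : (k.factorial : ℝ) ≠ 0 := by positivity
    have hk1 : (k + 1 : ℝ) ≠ 0 := by positivity
    simp only [smul_eq_mul, mul_one, Nat.add_sub_cancel, smul_add]
    have e1 : ((-1 : ℝ) ^ k / ((k + 1).factorial : ℕ)) •
        ((dirDeriv s y)^[k] g * ((k + 1) • τ ^ k)) =
        ((-1 : ℝ) ^ k / k.factorial) • (τ ^ k * (dirDeriv s y)^[k] g) := by
      rw [mul_smul_comm, ← Nat.cast_smul_eq_nsmul ℝ, smul_smul, mul_comm (τ ^ k), hf]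
      congr 1
      push_cast
      field_simp
    rw [e1, add_comm, sub_eq_add_neg, ← neg_smul]
    congr 2
    rw [pow_succ]; ring
  unfold primitive
  rw [map_sum, Finset.sum_congr rfl fun k _ => key k, Finset.sum_range_sub', hg.totalDegree h0]
  simp only [a, dirDeriv_iterate_eq_zero s hg]
  simp

end Primitive
-- Bases selected from a list: closures, levels, greedy choice
section ListBasisTheory

variable {U : Type*} [AddCommGroup U] [Module ℝ U] {N r : ℕ} {X : Fin N → U}

namespace ListBasis

theorem ext_idx {B D : ListBasis r X} (h : B.idx = D.idx) : B = D := by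
  cases B; cases D; cases h; rfl

/-- A basis selected from a list, as a basis of the vector space. -/
noncomputable def basis (B : ListBasis r X) : Module.Basis (Fin r) ℝ U :=
  Module.Basis.mk B.linInd B.span_eq.ge

@[simp]
theorem basis_apply (B : ListBasis r X) (i : Fin r) : B.basis i = B.vec i := by
  simp [basis, vec]

theorem coe_basis (B : ListBasis r X) : ⇑B.basis = B.vec := funext B.basis_apply

/-- The coordinate functionals of a basis selected from a list. -/
noncomputable def coord (B : ListBasis r X) (i : Fin r) : U →ₗ[ℝ] ℝ := B.basis.coord i

theorem coord_vec (B : ListBasis r X) (i j : Fin r) :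
    B.coord i (B.vec j) = if j = i then 1 else 0 := by
  rw [← basis_apply, coord, Module.Basis.coord_apply, Module.Basis.repr_self,
    Finsupp.single_apply]

theorem sum_coord (B : ListBasis r X) (u : U) : ∑ i, B.coord i u • B.vec i = u := by
  simpa [coord] using B.basis.sum_repr u

theorem mem_span_vec_iff (B : ListBasis r X) (J : Fin r → Prop) (u : U) :
    u ∈ Submodule.span ℝ {v | ∃ j, J j ∧ v = B.vec j} ↔ ∀ j, ¬ J j → B.coord j u = 0 := by
  have h : {v | ∃ j, J j ∧ v = B.vec j} = B.basis '' {j | J j} := by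
    ext v; simp [eq_comm]
  rw [h, Module.Basis.mem_span_image]
  simp only [Set.subset_def, Finset.mem_coe, Finsupp.mem_support_iff, Set.mem_ofPred_eq, coord,
    Module.Basis.coord_apply]
  exact forall_congr' fun j => by tauto

theorem mem_flag_iff (B : ListBasis r X) (k : ℕ) (u : U) :
    u ∈ B.flag k ↔ ∀ j : Fin r, k ≤ j → B.coord j u = 0 := by
  rw [flag, B.mem_span_vec_iff]
  simp

/-- The span of the elements of the basis up to a given position. -/
def below (B : ListBasis r X) (e : Fin N) : Submodule ℝ U :=
  Submodule.span ℝ {u | ∃ j : Fin r, B.idx j ≤ e ∧ u = B.vec j}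

theorem below_mono (B : ListBasis r X) {e e' : Fin N} (h : e ≤ e') : B.below e ≤ B.below e' :=
  Submodule.span_mono fun _ ⟨j, hj, hu⟩ => ⟨j, hj.trans h, hu⟩

theorem vec_mem_below (B : ListBasis r X) {j : Fin r} {e : Fin N} (h : B.idx j ≤ e) :
    B.vec j ∈ B.below e := Submodule.subset_span ⟨j, h, rfl⟩

theorem mem_below_iff (B : ListBasis r X) (e : Fin N) (u : U) :
    u ∈ B.below e ↔ ∀ j, e < B.idx j → B.coord j u = 0 := by
  rw [below, B.mem_span_vec_iff]
  simp

theorem mem_support {B : ListBasis r X} {e : Fin N} : e ∈ B.support ↔ ∃ j, B.idx j = e := by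
  simp [support]

/-- The set `B ∪ E(B)`. -/
noncomputable def clos (B : ListBasis r X) : Finset (Fin N) := B.support ∪ B.extActive

theorem mem_extActive {B : ListBasis r X} {e : Fin N} :
    e ∈ B.extActive ↔ e ∉ B.support ∧ X e ∈ B.below e := by
  simp [extActive, below]

theorem mem_clos {B : ListBasis r X} {e : Fin N} : e ∈ B.clos ↔ X e ∈ B.below e := by
  rw [clos, Finset.mem_union, mem_extActive]
  constructor
  · rintro (h | h)
    · obtain ⟨j, rfl⟩ := mem_support.1 h
      exact B.vec_mem_below le_rfl
    · exact h.2
  · tauto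

/-- The elements of `B ∪ E(B)` before `e` span the same space as the elements of `B` before `e`.
Hence `B` is recovered greedily from `B ∪ E(B)`, which makes `clos` injective. -/
theorem mem_support_iff_of_clos (B : ListBasis r X) (e : Fin N) :
    e ∈ B.support ↔ e ∈ B.clos ∧
      X e ∉ Submodule.span ℝ {u | ∃ c, c ∈ B.clos ∧ c < e ∧ u = X c} := by
  have hspan : Submodule.span ℝ {u | ∃ c, c ∈ B.clos ∧ c < e ∧ u = X c} =
      Submodule.span ℝ {u | ∃ j : Fin r, B.idx j < e ∧ u = B.vec j} := by
    apply le_antisymm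
    · rw [Submodule.span_le]
      rintro _ ⟨c, hc, hce, rfl⟩
      refine Submodule.span_mono ?_ (mem_clos.1 hc)
      rintro _ ⟨j, hj, rfl⟩
      exact ⟨j, hj.trans_lt hce, rfl⟩
    · apply Submodule.span_mono
      rintro _ ⟨j, hj, rfl⟩
      exact ⟨B.idx j, mem_clos.2 (B.vec_mem_below le_rfl), hj, rfl⟩
  rw [hspan]
  constructor
  · intro h
    refine ⟨Finset.mem_union_left _ h, fun hm => ?_⟩
    obtain ⟨j, rfl⟩ := mem_support.1 h
    rw [B.mem_span_vec_iff] at hm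
    have := hm j (lt_irrefl _)
    change B.coord j (B.vec j) = 0 at this
    simp [coord_vec] at this
  · rintro ⟨h1, h2⟩
    by_contra hs
    refine h2 (Submodule.span_mono ?_ (mem_clos.1 h1))
    rintro _ ⟨j, hj, rfl⟩
    refine ⟨j, lt_of_le_of_ne hj fun hje => hs (mem_support.2 ⟨j, hje⟩), rfl⟩

theorem eq_of_clos_eq {B D : ListBasis r X} (h : B.clos = D.clos) : B = D := by
  have hs : B.support = D.support := by
    ext e
    rw [mem_support_iff_of_clos, mem_support_iff_of_clos, h]
  apply ext_idx
  apply DFunLike.coe_injective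
  refine StrictMono.range_inj B.idx.strictMono D.idx.strictMono |>.1 ?_
  ext e
  have := Finset.ext_iff.1 hs e
  rwa [mem_support, mem_support] at this

/-- The elements of `X ∖ E(B)` in `S_{k+1} ∖ S_k`. -/
noncomputable def level (B : ListBasis r X) (k : Fin r) : Finset (Fin N) := by
  classical exact {e | e ∉ B.extActive ∧ (∀ j, k < j → B.coord j (X e) = 0) ∧ B.coord k (X e) ≠ 0}

theorem mem_level {B : ListBasis r X} {k : Fin r} {e : Fin N} : e ∈ B.level k ↔
    e ∉ B.extActive ∧ (∀ j, k < j → B.coord j (X e) = 0) ∧ B.coord k (X e) ≠ 0 := by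
  simp [level]

theorem idx_mem_level (B : ListBasis r X) (k : Fin r) : B.idx k ∈ B.level k := by
  refine mem_level.2 ⟨fun h => (mem_extActive.1 h).1 (mem_support.2 ⟨k, rfl⟩), fun j hj => ?_, ?_⟩
  · change B.coord j (B.vec k) = 0
    rw [coord_vec, if_neg hj.ne]
  · change B.coord k (B.vec k) ≠ 0
    simp [coord_vec]

/-- The elements of `X ∖ E(B)` in `S_{k+1} ∖ S_k`, without the basis element. -/
noncomputable def levelRest (B : ListBasis r X) (k : Fin r) : Finset (Fin N) :=
  (B.level k).erase (B.idx k)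

/-- An element of level `k` coming after `b_k` would be spanned by basis elements that all precede
it, hence be externally active. -/
theorem le_idx_of_mem_level {B : ListBasis r X} {k : Fin r} {e : Fin N} (h : e ∈ B.level k) :
    e ≤ B.idx k := by
  obtain ⟨h1, h2, h3⟩ := mem_level.1 h
  by_contra! hlt
  by_cases hs : e ∈ B.support
  · obtain ⟨j, rfl⟩ := mem_support.1 hs
    have := h2 j (B.idx.lt_iff_lt.1 hlt)
    change B.coord j (B.vec j) = 0 at this
    simp [coord_vec] at this
  · refine h1 (mem_extActive.2 ⟨hs, (B.mem_below_iff _ _).2 fun j hj => h2 j ?_⟩)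
    exact B.idx.lt_iff_lt.1 (hlt.trans hj)

theorem level_unique {B : ListBasis r X} {k l : Fin r} {e : Fin N} (hk : e ∈ B.level k)
    (hl : e ∈ B.level l) : k = l := by
  obtain ⟨-, h2, h3⟩ := mem_level.1 hk
  obtain ⟨-, h2', h3'⟩ := mem_level.1 hl
  rcases lt_trichotomy k l with h | h | h
  · exact absurd (h2 _ h) h3'
  · exact h
  · exact absurd (h2' _ h) h3

theorem disjoint_levelRest (B : ListBasis r X) {k l : Fin r} (h : k ≠ l) :
    Disjoint (B.levelRest k) (B.levelRest l) :=
  Finset.disjoint_left.2 fun _ h1 h2 =>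
    h (level_unique (Finset.mem_of_mem_erase h1) (Finset.mem_of_mem_erase h2))

/-- The last nonzero coordinate of an element determines its level. This partition makes `Q_B` the
product over the levels with the basis elements removed. -/
theorem clos_compl_eq (B : ListBasis r X) : B.closᶜ = Finset.univ.biUnion B.levelRest := by
  ext e
  rw [Finset.mem_compl, Finset.mem_biUnion]
  constructor
  · intro h
    have hE : e ∉ B.extActive := fun h' => h (Finset.mem_union_right _ h')
    have hne : (Finset.univ.filter fun j => B.coord j (X e) ≠ 0).Nonempty := by
      by_contra h0
      refine h (mem_clos.2 ((B.mem_below_iff _ _).2 fun j _ => ?_))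
      by_contra hj
      exact h0 ⟨j, by simpa using hj⟩
    refine ⟨_, Finset.mem_univ (Finset.max' _ hne), Finset.mem_erase.2 ⟨?_, ?_⟩⟩
    · intro he
      exact h (Finset.mem_union_left _ (mem_support.2 ⟨_, he.symm⟩))
    · refine mem_level.2 ⟨hE, fun j hj => ?_, ?_⟩
      · by_contra hj'
        exact absurd (Finset.le_max' _ j (by simpa using hj')) (not_le.2 hj)
      · simpa using Finset.max'_mem _ hne
  · rintro ⟨k, -, hk⟩ hc
    have hl := mem_level.1 (Finset.mem_of_mem_erase hk)
    rcases Finset.mem_union.1 hc with hs | hs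
    · obtain ⟨j, rfl⟩ := mem_support.1 hs
      rw [level_unique (Finset.mem_of_mem_erase hk) (B.idx_mem_level j)] at hk
      simp [levelRest] at hk
    · exact hl.1 hs

/-- By induction on `j`: the chosen element of level `j` does not come after `d_j` and has nonzero
`j`-th coordinate. Solving for `d_j` expresses it through that element and earlier `d_i`, all of
which lie in the span of the `b` up to the position of `d_j`. -/
theorem clos_subset_of_level {B D : ListBasis r X}
    (h : ∀ k, ∃ e ∈ D.level k, e ∈ B.clos) : D.clos ⊆ B.clos := by
  have key : ∀ j, D.vec j ∈ B.below (D.idx j) := by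
    intro j
    induction j using WellFoundedLT.induction with
    | ind j ih =>
      obtain ⟨e, he, heB⟩ := h j
      obtain ⟨-, h2, h3⟩ := mem_level.1 he
      have hXe : X e ∈ B.below (D.idx j) := B.below_mono (le_idx_of_mem_level he) (mem_clos.1 heB)
      rw [← D.sum_coord (X e), ← Finset.add_sum_erase _ _ (Finset.mem_univ j)] at hXe
      have hrest : ∑ i ∈ Finset.univ.erase j, D.coord i (X e) • D.vec i ∈ B.below (D.idx j) := by
        refine Submodule.sum_mem _ fun i hi => ?_
        rcases lt_or_gt_of_ne (Finset.ne_of_mem_erase hi) with hij | hij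
        · exact Submodule.smul_mem _ _ (B.below_mono (D.idx.monotone hij.le) (ih i hij))
        · rw [h2 i hij, zero_smul]; exact Submodule.zero_mem _
      exact (Submodule.smul_mem_iff _ h3).1 ((Submodule.add_mem_iff_left _ hrest).1 hXe)
  intro e he
  refine mem_clos.2 ?_
  have hle : D.below e ≤ B.below e := by
    rw [below, Submodule.span_le]
    rintro _ ⟨j, hj, rfl⟩
    exact B.below_mono hj (key j)
  exact hle (mem_clos.1 he)

theorem span_clos (B : ListBasis r X) :
    Submodule.span ℝ {u | ∃ e, e ∈ B.clos ∧ u = X e} = ⊤ := by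
  rw [eq_top_iff, ← B.span_eq]
  apply Submodule.span_mono
  rintro _ ⟨i, rfl⟩
  exact ⟨B.idx i, Finset.mem_union_left _ (mem_support.2 ⟨i, rfl⟩), rfl⟩

/-- Greedy selection of a basis from a spanning sublist. -/
theorem exists_greedy (s : Module.Basis (Fin r) ℝ U) (Z : Finset (Fin N))
    (hZ : Submodule.span ℝ {u | ∃ e, e ∈ Z ∧ u = X e} = ⊤) :
    ∃ B : ListBasis r X, B.support ⊆ Z ∧ Z ⊆ B.clos := by
  classical
  let S : Finset (Fin N) :=
    Z.filter fun e => X e ∉ Submodule.span ℝ {u | ∃ c, c ∈ Z ∧ c < e ∧ u = X c}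
  -- The largest element is added last, so everything already present precedes it and cannot span
  -- it.
  have hli : ∀ T : Finset (Fin N), T ⊆ S → LinearIndepOn ℝ X (T : Set (Fin N)) := by
    intro T
    induction T using Finset.induction_on_max with
    | empty => simp
    | insert a T ha ih =>
      intro hT
      rw [Finset.coe_insert]
      refine (ih ((Finset.subset_insert _ _).trans hT)).insert fun hmem => ?_
      refine (Finset.mem_filter.1 (hT (Finset.mem_insert_self a T))).2
        (Submodule.span_mono ?_ hmem)
      rintro _ ⟨c, hc, rfl⟩
      exact ⟨c, (Finset.mem_filter.1 (hT (Finset.mem_insert_of_mem hc))).1, ha c hc, rfl⟩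
  have hsp : ∀ e ∈ Z, X e ∈ Submodule.span ℝ {u | ∃ c, c ∈ S ∧ c ≤ e ∧ u = X c} := by
    intro e
    induction e using WellFoundedLT.induction with
    | ind e ih =>
      intro he
      by_cases hS : e ∈ S
      · exact Submodule.subset_span ⟨e, hS, le_rfl, rfl⟩
      · have hmem : X e ∈ Submodule.span ℝ {u | ∃ c, c ∈ Z ∧ c < e ∧ u = X c} := by
          by_contra hn; exact hS (Finset.mem_filter.2 ⟨he, hn⟩)
        refine Submodule.span_le.2 ?_ hmem
        rintro _ ⟨c, hc, hce, rfl⟩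
        refine Submodule.span_mono ?_ (ih c hce hc)
        rintro _ ⟨d, hd, hdc, rfl⟩
        exact ⟨d, hd, hdc.trans hce.le, rfl⟩
  have hliS := hli S subset_rfl
  have hspan : Submodule.span ℝ (Set.range fun e : S => X e) = ⊤ := by
    rw [eq_top_iff, ← hZ, Submodule.span_le]
    rintro _ ⟨e, he, rfl⟩
    refine Submodule.span_mono ?_ (hsp e he)
    rintro _ ⟨c, hc, -, rfl⟩
    exact ⟨⟨c, hc⟩, rfl⟩
  have hliS' : LinearIndependent ℝ fun e : S => X e := hliS
  have hcard : S.card = r := by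
    have h1 := Module.finrank_eq_card_basis (Module.Basis.mk hliS' hspan.ge)
    have h2 := Module.finrank_eq_card_basis s
    simpa [h1] using h2
  have hrange : Set.range (S.orderEmbOfFin hcard) = S := Finset.range_orderEmbOfFin S hcard
  let B : ListBasis r X :=
    { idx := S.orderEmbOfFin hcard
      linInd := by
        have := hliS'.comp (S.orderIsoOfFin hcard) (S.orderIsoOfFin hcard).injective
        exact this
      span_eq := by
        rw [← hspan]
        congr 1
        ext u
        constructor
        · rintro ⟨i, rfl⟩
          exact ⟨⟨_, S.orderEmbOfFin_mem hcard i⟩, rfl⟩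
        · rintro ⟨⟨e, he⟩, rfl⟩
          rw [← Finset.mem_coe, ← hrange] at he
          obtain ⟨i, rfl⟩ := he
          exact ⟨i, rfl⟩ }
  have hsupp : ∀ e, e ∈ B.support ↔ e ∈ S := by
    intro e
    rw [mem_support, ← Finset.mem_coe, ← hrange]
    rfl
  refine ⟨B, fun e he => (Finset.mem_filter.1 ((hsupp e).1 he)).1, fun e he => mem_clos.2 ?_⟩
  refine Submodule.span_mono ?_ (hsp e he)
  rintro _ ⟨c, hc, hce, rfl⟩
  obtain ⟨j, rfl⟩ := mem_support.1 ((hsupp c).2 hc)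
  exact ⟨j, hce, rfl⟩

end ListBasis

/-- If `T` meets all bases, some nonzero functional vanishes on the elements outside of `T`. -/
theorem MeetsBases.exists_dual (s : Module.Basis (Fin r) ℝ U) {T : Finset (Fin N)}
    (hT : MeetsBases r X T) : ∃ l : U →ₗ[ℝ] ℝ, l ≠ 0 ∧ ∀ e ∉ T, l (X e) = 0 := by
  have hne : Submodule.span ℝ {u | ∃ e, e ∈ Tᶜ ∧ u = X e} ≠ ⊤ := by
    intro h
    obtain ⟨B, hB, -⟩ := ListBasis.exists_greedy s _ h
    obtain ⟨e, he⟩ := hT B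
    rw [Finset.mem_inter] at he
    exact Finset.mem_compl.1 (hB he.2) he.1
  obtain ⟨l, hl, hle⟩ := Submodule.exists_le_ker_of_lt_top _ (lt_top_iff_ne_top.2 hne)
  exact ⟨l, hl, fun e he => hle (Submodule.subset_span ⟨e, Finset.mem_compl.2 he, rfl⟩)⟩

/-- A sublist whose complement does not span contains a cocircuit. -/
theorem exists_isCocircuit_subset {T : Finset (Fin N)}
    (hT : Submodule.span ℝ {u | ∃ e, e ∉ T ∧ u = X e} ≠ ⊤) :
    ∃ C ⊆ T, IsCocircuit r X C := by
  have hm : MeetsBases r X T := by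
    intro B
    by_contra h
    refine hT (eq_top_iff.2 ?_)
    rw [← B.span_eq]
    apply Submodule.span_mono
    rintro _ ⟨i, rfl⟩
    refine ⟨B.idx i, fun hi => h ⟨B.idx i, ?_⟩, rfl⟩
    exact Finset.mem_inter.2 ⟨hi, ListBasis.mem_support.2 ⟨i, rfl⟩⟩
  obtain ⟨C, hC, hmin⟩ := exists_minimal_le_of_wellFoundedLT (MeetsBases r X) T hm
  exact ⟨C, hC, hmin⟩

/-- Take the least `k` with `l (d_k) ≠ 0`. On level `k` the coordinates above `k` are zero and `l`
is zero on the `d_j` below, so `l (X e)` is the nonzero `k`-th coordinate times `l (d_k)`, and `e`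
must lie in `T`. -/
theorem exists_level_subset {T : Finset (Fin N)} {l : U →ₗ[ℝ] ℝ} (hl : l ≠ 0)
    (hT : ∀ e ∉ T, l (X e) = 0) (D : ListBasis r X) : ∃ k, D.level k ⊆ T := by
  have hne : (Finset.univ.filter fun j => l (D.vec j) ≠ 0).Nonempty := by
    by_contra h0
    refine hl (D.basis.ext fun j => ?_)
    by_contra hj
    exact h0 ⟨j, by simpa using hj⟩
  refine ⟨Finset.min' _ hne, fun e he => ?_⟩
  obtain ⟨-, h2, h3⟩ := ListBasis.mem_level.1 he
  by_contra heT
  have h := hT e heT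
  rw [← D.sum_coord (X e), map_sum, Finset.sum_eq_single (Finset.min' _ hne)] at h
  · rw [map_smul, smul_eq_mul, mul_eq_zero] at h
    exact h.elim h3 (by simpa using Finset.min'_mem _ hne)
  · intro j _ hj
    rw [map_smul, smul_eq_mul, mul_eq_zero]
    rcases lt_or_gt_of_ne hj with hj | hj
    · right
      by_contra hj'
      exact absurd (Finset.min'_le _ j (by simpa using hj')) (not_le.2 hj)
    · exact Or.inl (h2 _ hj)
  · simp

end ListBasisTheory
-- The dual polynomials and their pairing with `Q_B`
section BasisPolynomial

variable {U : Type*} [NormedAddCommGroup U] [NormedSpace ℝ U] {N r : ℕ}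
  (s : Module.Basis (Fin r) ℝ U) {X : Fin N → U}

theorem prodForm_insert {A : Finset (Fin N)} {a : Fin N} (h : a ∉ A) :
    prodForm s X (insert a A) = linForm s (X a) * prodForm s X A := Finset.prod_insert h

theorem prodForm_dvd {A A' : Finset (Fin N)} (h : A ⊆ A') : prodForm s X A ∣ prodForm s X A' :=
  Finset.prod_dvd_prod_of_subset _ _ _ h

variable {s} in
theorem diffOp_eq_zero_of_dvd {p q f : MvPolynomial (Fin r) ℝ} (h : p ∣ q)
    (hp : diffOp p f = 0) : diffOp q f = 0 := by
  obtain ⟨c, rfl⟩ := h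
  rw [mul_comm, diffOp_mul, hp, map_zero]

theorem isHomogeneous_diffOp_prodForm {n : ℕ} {f : MvPolynomial (Fin r) ℝ}
    (hf : f.IsHomogeneous n) (A : Finset (Fin N)) :
    (diffOp (prodForm s X A) f).IsHomogeneous (n - A.card) := by
  induction A using Finset.induction_on with
  | empty => simpa [prodForm, diffOp_one] using hf
  | insert a A ha ih =>
    rw [prodForm_insert s ha, diffOp_mul, diffOp_linForm, Finset.card_insert_of_notMem ha,
      ← Nat.sub_sub]
    exact isHomogeneous_dirDeriv s ih _

theorem VanishesOnKer.diffOp_prodForm {η : U →ₗ[ℝ] ℝ} {f : MvPolynomial (Fin r) ℝ}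
    (hf : VanishesOnKer s η f) {A : Finset (Fin N)} (hA : ∀ e ∈ A, η (X e) = 0) :
    VanishesOnKer s η (diffOp (prodForm s X A) f) := by
  induction A using Finset.induction_on with
  | empty => simpa [prodForm, diffOp_one] using hf
  | insert a A ha ih =>
    rw [prodForm_insert s ha, diffOp_mul, diffOp_linForm]
    exact (ih fun e he => hA e (Finset.mem_insert_of_mem he)).dirDeriv
      (hA a (Finset.mem_insert_self a A))

/-- Differentiating along the hyperplane preserves vanishing on it, and `p_A(∂)` commutes with
`∂_y`. So the result vanishes on the hyperplane and has zero `y`-derivative. -/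
theorem diffOp_prodForm_primitive_eq_zero {η : U →ₗ[ℝ] ℝ} {n : ℕ} {g : MvPolynomial (Fin r) ℝ}
    (hg : g.IsHomogeneous n) {y : U} (hy : η y ≠ 0) {A : Finset (Fin N)}
    (hA : ∀ e ∈ A, η (X e) = 0) (h : diffOp (prodForm s X A) g = 0) :
    diffOp (prodForm s X A) (primitive s η y g) = 0 := by
  refine ((vanishesOnKer_primitive y g).diffOp_prodForm s hA).eq_zero hy ?_
  rw [← diffOp_linForm, ← diffOp_mul, mul_comm, diffOp_mul, diffOp_linForm,
    dirDeriv_primitive hg hy, h]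

/-- Iterated primitives along the vectors of a list of positions. -/
noncomputable def primitives (η : U →ₗ[ℝ] ℝ) (X : Fin N → U) (l : List (Fin N))
    (g : MvPolynomial (Fin r) ℝ) : MvPolynomial (Fin r) ℝ :=
  l.foldr (fun e f => primitive s η (X e) f) g

theorem primitives_cons (η : U →ₗ[ℝ] ℝ) (e : Fin N) (l : List (Fin N))
    (g : MvPolynomial (Fin r) ℝ) :
    primitives s η X (e :: l) g = primitive s η (X e) (primitives s η X l g) := rfl

theorem isHomogeneous_primitives {n : ℕ} {g : MvPolynomial (Fin r) ℝ} (hg : g.IsHomogeneous n)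
    (η : U →ₗ[ℝ] ℝ) (l : List (Fin N)) :
    (primitives s η X l g).IsHomogeneous (n + l.length) := by
  induction l with
  | nil => exact hg
  | cons e l ih =>
    rw [primitives_cons, List.length_cons, ← add_assoc]
    exact isHomogeneous_primitive ih _

theorem diffOp_prodForm_primitives_eq_zero {η : U →ₗ[ℝ] ℝ} {n : ℕ}
    {g : MvPolynomial (Fin r) ℝ} (hg : g.IsHomogeneous n) {l : List (Fin N)}
    (hl : ∀ e ∈ l, η (X e) ≠ 0) {A : Finset (Fin N)}
    (hA : ∀ e ∈ A, η (X e) = 0) (h : diffOp (prodForm s X A) g = 0) :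
    diffOp (prodForm s X A) (primitives s η X l g) = 0 := by
  induction l with
  | nil => exact h
  | cons e l ih =>
    rw [primitives_cons]
    exact diffOp_prodForm_primitive_eq_zero s (isHomogeneous_primitives s hg η l)
      (hl e List.mem_cons_self) hA (ih fun e' he' => hl e' (List.mem_cons_of_mem _ he'))

theorem diffOp_primitives {η : U →ₗ[ℝ] ℝ} {n : ℕ}
    {g : MvPolynomial (Fin r) ℝ} (hg : g.IsHomogeneous n) {l : List (Fin N)}
    (hl : ∀ e ∈ l, η (X e) ≠ 0) :
    diffOp (l.map fun e => linForm s (X e)).prod (primitives s η X l g) = g := by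
  induction l with
  | nil => simp [diffOp_one, primitives]
  | cons e l ih =>
    rw [primitives_cons, List.map_cons, List.prod_cons, mul_comm, diffOp_mul, diffOp_linForm,
      dirDeriv_primitive (isHomogeneous_primitives s hg η l) (hl e List.mem_cons_self),
      ih fun e' he' => hl e' (List.mem_cons_of_mem _ he')]

namespace ListBasis

variable {s} (D : ListBasis r X)

theorem coord_ne_zero_of_mem_levelRest {k : Fin r} {e : Fin N}
    (he : e ∈ (D.levelRest k).toList) : D.coord k (X e) ≠ 0 :=
  (mem_level.1 (Finset.mem_of_mem_erase (Finset.mem_toList.1 he))).2.2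

variable (s) in
/-- The density of `R_1^D * ⋯ * R_k^D` on `S_k`, in the coordinates of the basis `D`, as a
polynomial on the whole space. -/
noncomputable def partialPoly (k : Fin (r + 1)) : MvPolynomial (Fin r) ℝ :=
  Fin.induction (motive := fun _ => MvPolynomial (Fin r) ℝ) 1
    (fun k g => primitives s (D.coord k) X (D.levelRest k).toList g) k

theorem partialPoly_zero : D.partialPoly s 0 = 1 := rfl

theorem partialPoly_succ (k : Fin r) : D.partialPoly s k.succ =
    primitives s (D.coord k) X (D.levelRest k).toList (D.partialPoly s k.castSucc) := by
  simp [partialPoly]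

theorem levels_succ (k : Fin r) : (Finset.univ.filter fun j : Fin r => j.castSucc < k.succ) =
    insert k (Finset.univ.filter fun j : Fin r => j.castSucc < k.castSucc) := by
  ext j
  simp only [Finset.mem_filter, Finset.mem_univ, true_and, Finset.mem_insert, Fin.lt_def,
    Fin.val_castSucc, Fin.val_succ, Fin.ext_iff]
  omega

theorem isHomogeneous_partialPoly (k : Fin (r + 1)) : (D.partialPoly s k).IsHomogeneous
    (∑ j ∈ Finset.univ.filter fun j : Fin r => j.castSucc < k, (D.levelRest j).card) := by
  induction k using Fin.induction with
  | zero => simpa [partialPoly_zero] using isHomogeneous_one (Fin r) ℝ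
  | succ k ih =>
    rw [partialPoly_succ, levels_succ, Finset.sum_insert (by simp), add_comm]
    simpa using isHomogeneous_primitives s ih (D.coord k) (D.levelRest k).toList

theorem diffOp_levelRest (k : Fin r) : diffOp (prodForm s X (D.levelRest k))
    (D.partialPoly s k.succ) = D.partialPoly s k.castSucc := by
  rw [partialPoly_succ, prodForm, ← Finset.prod_map_toList]
  exact diffOp_primitives s (D.isHomogeneous_partialPoly _)
    fun e he => D.coord_ne_zero_of_mem_levelRest he

/-- The density on `S_k` is extended constantly along the remaining basis vectors. This holds for
`1` and survives the primitives of level `k < j`, because `d_j` lies in the kernel of the `k`-th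
coordinate. -/
theorem dirDeriv_partialPoly (k : Fin (r + 1)) (j : Fin r) (hj : k ≤ j.castSucc) :
    dirDeriv s (D.vec j) (D.partialPoly s k) = 0 := by
  have h : prodForm s X {D.idx j} = linForm s (D.vec j) := Finset.prod_singleton _ _
  rw [← diffOp_linForm, ← h]
  induction k using Fin.induction with
  | zero =>
    rw [h, diffOp_linForm, partialPoly_zero]
    exact Derivation.map_one_eq_zero _
  | succ k ih =>
    rw [partialPoly_succ]
    have hkj : k < j := by simpa using hj
    refine diffOp_prodForm_primitives_eq_zero s (D.isHomogeneous_partialPoly _)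
      (fun e he => D.coord_ne_zero_of_mem_levelRest he) ?_ (ih (by simpa using hkj.le))
    intro e he
    rw [Finset.mem_singleton.1 he]
    change D.coord k (D.vec j) = 0
    rw [coord_vec, if_neg hkj.ne']

/-- Right after level `k`, the elements other than `d_k` undo its primitives, and `∂_{d_k}` kills
what remains. Later primitives preserve this, since level `k` lies in the kernel of every later
coordinate. -/
theorem diffOp_level_partialPoly (k : Fin r) (m : Fin (r + 1)) (hm : k.castSucc < m) :
    diffOp (prodForm s X (D.level k)) (D.partialPoly s m) = 0 := by
  induction m using Fin.induction with
  | zero => simp at hm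
  | succ m ih =>
    rcases eq_or_ne k m with rfl | hne
    · have hl : D.level k = insert (D.idx k) (D.levelRest k) :=
        (Finset.insert_erase (D.idx_mem_level k)).symm
      rw [hl, prodForm_insert s (by simp [levelRest]), diffOp_mul, diffOp_levelRest,
        diffOp_linForm]
      exact D.dirDeriv_partialPoly _ _ le_rfl
    · have hkm : k < m := by
        rw [Fin.lt_def] at hm ⊢
        rw [Ne, Fin.ext_iff] at hne
        simp at hm
        omega
      rw [partialPoly_succ]
      exact diffOp_prodForm_primitives_eq_zero s (D.isHomogeneous_partialPoly _)
        (fun e he => D.coord_ne_zero_of_mem_levelRest he)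
        (fun e he => (mem_level.1 he).2.1 m hkm) (ih (by simpa using hkm))

theorem diffOp_partialPoly (k : Fin (r + 1)) :
    diffOp (∏ j ∈ Finset.univ.filter fun j : Fin r => j.castSucc < k,
      prodForm s X (D.levelRest j)) (D.partialPoly s k) = 1 := by
  induction k using Fin.induction with
  | zero => simp [partialPoly_zero, diffOp_one]
  | succ k ih =>
    rw [levels_succ, Finset.prod_insert (by simp), mul_comm, diffOp_mul, diffOp_levelRest, ih]

variable (s) in
/-- The dual basis element belonging to `D`: the density of `R^D` in the coordinates of `D`. -/
noncomputable def dualPoly : MvPolynomial (Fin r) ℝ := D.partialPoly s (Fin.last r)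

theorem levels_last : (Finset.univ.filter fun j : Fin r => j.castSucc < Fin.last r) =
    Finset.univ := Finset.filter_true_of_mem fun j _ => j.castSucc_lt_last

theorem isHomogeneous_dualPoly : (D.dualPoly s).IsHomogeneous D.closᶜ.card := by
  have := D.isHomogeneous_partialPoly (s := s) (Fin.last r)
  rwa [levels_last, ← Finset.card_biUnion fun i _ j _ hij => D.disjoint_levelRest hij,
    ← clos_compl_eq] at this

variable (s) in
theorem polyQ_eq : polyQ s X D = prodForm s X D.closᶜ := rfl

theorem pairing_self : pairing (polyQ s X D) (D.dualPoly s) = 1 := by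
  have := D.diffOp_partialPoly (s := s) (Fin.last r)
  unfold prodForm at this
  rw [levels_last, ← Finset.prod_biUnion fun i _ j _ hij => D.disjoint_levelRest hij,
    ← clos_compl_eq] at this
  rw [pairing, polyQ_eq, prodForm, dualPoly, this, map_one]

/-- If some level of `D` avoids `B ∪ E(B)`, its product divides `Q_B` and annihilates. Otherwise
`clos D` is strictly inside `clos B`, so `Q_B(∂)` leaves a form of positive degree, which is zero at
the origin. -/
theorem pairing_of_ne {B : ListBasis r X} (h : B ≠ D) :
    pairing (polyQ s X B) (D.dualPoly s) = 0 := by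
  rw [polyQ_eq]
  by_cases hlev : ∀ k, ∃ e ∈ D.level k, e ∈ B.clos
  · have hlt : B.closᶜ.card < D.closᶜ.card := by
      apply Finset.card_lt_card
      rw [Finset.compl_ssubset_compl]
      exact (clos_subset_of_level hlev).ssubset_of_ne fun h' => h (eq_of_clos_eq h'.symm)
    have hh := isHomogeneous_diffOp_prodForm s (X := X) (D.isHomogeneous_dualPoly (s := s)) B.closᶜ
    rw [pairing, constantCoeff_eq]
    refine hh.coeff_eq_zero ?_
    simp
    omega
  · push Not at hlev
    obtain ⟨k, hk⟩ := hlev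
    rw [pairing, dualPoly, diffOp_eq_zero_of_dvd (prodForm_dvd s fun e he => Finset.mem_compl.2 (hk e he))
      (D.diffOp_level_partialPoly k _ k.castSucc_lt_last), map_zero]

open Classical in
theorem pairing_eq_ite (B : ListBasis r X) :
    pairing (polyQ s X B) (D.dualPoly s) = if B = D then 1 else 0 := by
  split_ifs with h
  · rw [h, pairing_self]
  · exact D.pairing_of_ne h

theorem dualPoly_mem_spaceD : D.dualPoly s ∈ spaceD s X := by
  intro q hq
  -- The whole polynomial vanishes, not just its value at the origin; only the stronger statement
  -- passes to multiples in the ideal.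
  have hz : diffOp q (D.dualPoly s) = 0 := by
    unfold cocircuitIdeal at hq
    induction hq using Submodule.span_induction with
    | mem q hq =>
      obtain ⟨T, hT, rfl⟩ := hq
      obtain ⟨l, hl, hlT⟩ := MeetsBases.exists_dual s hT.1
      obtain ⟨k, hk⟩ := exists_level_subset hl hlT D
      exact diffOp_eq_zero_of_dvd (prodForm_dvd s hk)
        (D.diffOp_level_partialPoly k _ k.castSucc_lt_last)
    | zero => rw [← diffOpHom_apply, map_zero, LinearMap.zero_apply]
    | add p q _ _ hp hq => rw [diffOp_add, hp, hq, add_zero]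
    | smul a q _ hq => rw [smul_eq_mul, diffOp_mul, hq, map_zero]
  rw [pairing, hz, map_zero]

end ListBasis

theorem linForm_mem_span {A : Set U} {u : U} (h : u ∈ Submodule.span ℝ A) :
    linForm s u ∈ Submodule.span ℝ (linForm s '' A) := by
  let L : U →ₗ[ℝ] MvPolynomial (Fin r) ℝ :=
    ∑ i, (s.coord i).smulRight (MvPolynomial.X i : MvPolynomial (Fin r) ℝ)
  have hL : ∀ v, L v = linForm s v := by
    intro v
    simp [L, linForm, smul_eq_C_mul]
  have hi : linForm s '' A = L '' A := Set.image_congr fun v _ => (hL v).symm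
  rw [hi, ← hL, ← Submodule.map_span]
  exact Submodule.mem_map_of_mem h

theorem polyQ_mem_spaceP (B : ListBasis r X) : polyQ s X B ∈ spaceP s X := by
  refine Submodule.subset_span ⟨B.closᶜ, ?_, B.polyQ_eq s⟩
  rw [← B.span_clos]
  congr 1
  ext u
  simp

/-- If every element of a spanning set of vectors gives a product in the submodule `M`, then so
does every vector. -/
theorem linForm_mul_mem {M : Submodule ℝ (MvPolynomial (Fin r) ℝ)} {A : Set U} {u : U}
    (hu : u ∈ Submodule.span ℝ A) {p : MvPolynomial (Fin r) ℝ}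
    (h : ∀ v ∈ A, linForm s v * p ∈ M) : linForm s u * p ∈ M := by
  have h1 : Submodule.span ℝ (linForm s '' A) ≤ M.comap (LinearMap.mulRight ℝ p) := by
    rw [Submodule.span_le]
    rintro _ ⟨v, hv, rfl⟩
    exact h v hv
  exact h1 (linForm_mem_span s hu)

/-- Induction on the sum of the positions in `Y`. Choose `B` greedily in the complement of `Y`. If
`Y` is not the complement of `clos B`, it contains an externally active `e`; expanding `X e` in
earlier basis elements replaces `e` by smaller positions. -/
theorem spaceP_le_span_polyQ : spaceP s X ≤ Submodule.span ℝ (Set.range (polyQ s X)) := by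
  rw [spaceP, Submodule.span_le]
  rintro _ ⟨Y, hY, rfl⟩
  obtain ⟨n, hn⟩ : ∃ n, n = ∑ e ∈ Y, (e : ℕ) := ⟨_, rfl⟩
  induction n using Nat.strong_induction_on generalizing Y with
  | _ n ih =>
    have hY' : Submodule.span ℝ {u | ∃ e, e ∈ Yᶜ ∧ u = X e} = ⊤ := by
      simpa only [Finset.mem_compl] using hY
    obtain ⟨B, hB, hYB⟩ := ListBasis.exists_greedy s _ hY'
    by_cases hE : Disjoint Y B.clos
    · have : Y = B.closᶜ := by
        ext e
        rw [Finset.mem_compl]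
        refine ⟨fun h => Finset.disjoint_left.1 hE h, fun h => ?_⟩
        by_contra he
        exact h (hYB (Finset.mem_compl.2 he))
      exact Submodule.subset_span ⟨B, by rw [B.polyQ_eq, this]⟩
    · obtain ⟨e, heY, he⟩ := Finset.not_disjoint_iff.1 hE
      have heB : e ∉ B.support := fun h => Finset.mem_compl.1 (hB h) heY
      rw [SetLike.mem_coe, ← Finset.insert_erase heY, prodForm_insert s (Finset.notMem_erase e Y)]
      -- Only the `b_j` with nonzero coefficient are used: for these, exchanging `e` and `b_j`
      -- leaves a spanning complement.
      have hXe : X e ∈ Submodule.span ℝ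
          {u | ∃ j : Fin r, (B.idx j ≤ e ∧ B.coord j (X e) ≠ 0) ∧ u = B.vec j} := by
        rw [B.mem_span_vec_iff]
        intro j hj
        by_contra hc
        refine hj ⟨?_, hc⟩
        by_contra hlt
        exact hc ((B.mem_below_iff _ _).1 (ListBasis.mem_clos.1 he) j (not_le.1 hlt))
      refine linForm_mul_mem s hXe ?_
      rintro _ ⟨j, ⟨hj, hc⟩, rfl⟩
      have hjY : B.idx j ∉ Y := Finset.mem_compl.1 (hB (ListBasis.mem_support.2 ⟨j, rfl⟩))
      have hje : B.idx j < e := lt_of_le_of_ne hj fun h => heB (ListBasis.mem_support.2 ⟨j, h⟩)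
      have hjn : B.idx j ∉ Y.erase e := fun h => hjY (Finset.mem_of_mem_erase h)
      have := ih (∑ e ∈ insert (B.idx j) (Y.erase e), (e : ℕ)) ?_ (insert (B.idx j) (Y.erase e))
        ?_ rfl
      · rwa [prodForm_insert s hjn] at this
      · rw [hn, Finset.sum_insert hjn, ← Finset.add_sum_erase _ _ heY]
        exact Nat.add_lt_add_right hje _
      · have hmem : ∀ e', e' ∉ Y → e' ≠ B.idx j → X e' ∈ Submodule.span ℝ
            {u | ∃ e', e' ∉ insert (B.idx j) (Y.erase e) ∧ u = X e'} := by
          intro e' h1 h2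
          refine Submodule.subset_span ⟨e', ?_, rfl⟩
          rw [Finset.mem_insert, not_or]
          exact ⟨h2, fun h => h1 (Finset.mem_of_mem_erase h)⟩
        have hbi : ∀ i, i ≠ j → B.vec i ∈ Submodule.span ℝ
            {u | ∃ e', e' ∉ insert (B.idx j) (Y.erase e) ∧ u = X e'} := by
          intro i hi
          exact hmem _ (Finset.mem_compl.1 (hB (ListBasis.mem_support.2 ⟨i, rfl⟩)))
            fun h => hi (B.idx.injective h)
        have hXe' : X e ∈ Submodule.span ℝ
            {u | ∃ e', e' ∉ insert (B.idx j) (Y.erase e) ∧ u = X e'} := by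
          refine Submodule.subset_span ⟨e, ?_, rfl⟩
          rw [Finset.mem_insert, not_or]
          exact ⟨hje.ne', Finset.notMem_erase e Y⟩
        rw [eq_top_iff, ← B.span_eq, Submodule.span_le]
        rintro _ ⟨i, rfl⟩
        by_cases hi : i = j
        · subst hi
          rw [← B.sum_coord (X e), ← Finset.add_sum_erase _ _ (Finset.mem_univ i)] at hXe'
          refine (Submodule.smul_mem_iff _ hc).1 ((Submodule.add_mem_iff_left _ ?_).1 hXe')
          exact Submodule.sum_mem _ fun i' hi' =>
            Submodule.smul_mem _ _ (hbi i' (Finset.ne_of_mem_erase hi'))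
        · exact hbi i hi

theorem span_polyQ : Submodule.span ℝ (Set.range (polyQ s X)) = spaceP s X := by
  refine le_antisymm ?_ (spaceP_le_span_polyQ s)
  rw [Submodule.span_le]
  rintro _ ⟨B, rfl⟩
  exact polyQ_mem_spaceP s B

/-- The sum contains `1` and is stable under multiplication by linear forms. It suffices to multiply
`p_Y` by `p_x` for `x ∉ Y`, as these `x` span: either the complement of `Y ∪ {x}` still spans, or `Y
∪ {x}` contains a cocircuit. -/
theorem spaceP_sup_cocircuitIdeal (hX : Submodule.span ℝ (Set.range X) = ⊤) :
    spaceP s X ⊔ (cocircuitIdeal s X).restrictScalars ℝ = ⊤ := by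
  set M := spaceP s X ⊔ (cocircuitIdeal s X).restrictScalars ℝ with hM
  have hstep : ∀ u, ∀ p ∈ M, linForm s u * p ∈ M := by
    intro u p hp
    obtain ⟨p, hp', q, hq, rfl⟩ := Submodule.mem_sup.1 hp
    rw [mul_add]
    refine add_mem ?_ (Submodule.mem_sup_right ?_)
    · clear hp
      replace hp : p ∈ Submodule.span ℝ _ := hp'
      clear hp'
      induction hp using Submodule.span_induction with
      | zero => rw [mul_zero]; exact zero_mem _
      | add p q _ _ hp hq => rw [mul_add]; exact add_mem hp hq
      | smul c p _ hp => rw [mul_smul_comm]; exact Submodule.smul_mem _ _ hp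
      | mem p hp =>
        obtain ⟨Y, hY, rfl⟩ := hp
        refine linForm_mul_mem s (A := {u | ∃ e ∉ Y, u = X e}) (by rw [hY]; trivial) ?_
        rintro _ ⟨e, he, rfl⟩
        rw [← prodForm_insert s he]
        by_cases hs : Submodule.span ℝ {u | ∃ e', e' ∉ insert e Y ∧ u = X e'} = ⊤
        · exact Submodule.mem_sup_left (Submodule.subset_span ⟨_, hs, rfl⟩)
        · obtain ⟨T, hT, hTc⟩ := exists_isCocircuit_subset (r := r) hs
          refine Submodule.mem_sup_right ?_
          change _ ∈ cocircuitIdeal s X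
          exact Ideal.mem_of_dvd _ (prodForm_dvd s hT) (Ideal.subset_span ⟨T, hTc, rfl⟩)
    · exact Ideal.mul_mem_left _ _ hq
  have hone : (1 : MvPolynomial (Fin r) ℝ) ∈ M := by
    refine Submodule.mem_sup_left (Submodule.subset_span ⟨∅, ?_, by simp [prodForm]⟩)
    rw [← hX]
    congr 1
    ext u
    simp [eq_comm]
  have hlin : ∀ i, linForm s (s i) = MvPolynomial.X i := by
    intro i
    rw [linForm, Finset.sum_eq_single i]
    · simp
    · intro j _ hj
      rw [s.repr_self, Finsupp.single_eq_of_ne hj, C_0, zero_mul]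
    · simp
  rw [eq_top_iff]
  rintro p -
  induction p using MvPolynomial.induction_on with
  | C a =>
    rw [← mul_one (C a), ← smul_eq_C_mul]
    exact Submodule.smul_mem _ _ hone
  | add p q hp hq => exact add_mem hp hq
  | mul_X p i hp =>
    rw [mul_comm, ← hlin i]
    exact hstep _ _ hp

theorem pairing_add_right (p f g : MvPolynomial (Fin r) ℝ) :
    pairing p (f + g) = pairing p f + pairing p g := by
  simp [pairing]

theorem pairing_smul_right (c : ℝ) (p f : MvPolynomial (Fin r) ℝ) :
    pairing p (c • f) = c * pairing p f := by
  simp [pairing]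

theorem pairing_add_left (p q f : MvPolynomial (Fin r) ℝ) :
    pairing (p + q) f = pairing p f + pairing q f := by
  rw [pairing, diffOp_add, map_add]; rfl

theorem pairing_smul_left (c : ℝ) (p f : MvPolynomial (Fin r) ℝ) :
    pairing (c • p) f = c * pairing p f := by
  rw [pairing, diffOp_smul, constantCoeff_smul]; rfl

/-- The pairing as a bilinear form. -/
noncomputable def pairingHom :
    MvPolynomial (Fin r) ℝ →ₗ[ℝ] MvPolynomial (Fin r) ℝ →ₗ[ℝ] ℝ :=
  LinearMap.mk₂ ℝ pairing pairing_add_left pairing_smul_left pairing_add_right pairing_smul_right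

theorem pairingHom_apply (p f : MvPolynomial (Fin r) ℝ) : pairingHom p f = pairing p f := rfl

/-- A polynomial that pairs to zero with all polynomials is zero. -/
theorem eq_zero_of_pairing {f : MvPolynomial (Fin r) ℝ} (h : ∀ p, pairing p f = 0) : f = 0 := by
  ext m
  rw [coeff_zero]
  induction hd : m.degree generalizing m f with
  | zero =>
    rw [Finsupp.degree_eq_zero_iff] at hd
    subst hd
    have := h 1
    rwa [pairing, diffOp_one, constantCoeff_eq] at this
  | succ d ih =>
    obtain ⟨i, hi⟩ : ∃ i, m i ≠ 0 := by
      by_contra! h0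
      have : m = 0 := Finsupp.ext h0
      simp [this] at hd
    have hm : m = m - Finsupp.single i 1 + Finsupp.single i 1 := by
      rw [tsub_add_cancel_of_le]
      simpa [Nat.one_le_iff_ne_zero] using hi
    have hdeg : (m - Finsupp.single i 1).degree = d := by
      rw [hm, map_add, Finsupp.degree_single] at hd
      omega
    have := ih (f := pderiv i f) (fun p => by
      rw [← diffOp_X, pairing, ← diffOp_mul]; exact h _) _ hdeg
    rw [coeff_pderiv, ← hm] at this
    exact (mul_eq_zero.1 this).resolve_right (by positivity)

theorem linearIndependent_dualPoly :
    LinearIndependent ℝ fun B : ListBasis r X => B.dualPoly s := by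
  classical
  rw [linearIndependent_iff']
  intro S g hg B hB
  have := congrArg (pairingHom (polyQ s X B)) hg
  rw [map_sum, map_zero, Finset.sum_eq_single B] at this
  · simpa [pairingHom_apply, ListBasis.pairing_self] using this
  · intro D _ hD
    rw [map_smul, pairingHom_apply, D.pairing_of_ne hD.symm, smul_zero]
  · exact fun h => absurd hB h

theorem linearIndependent_polyQ : LinearIndependent ℝ (polyQ s X) := by
  classical
  rw [linearIndependent_iff']
  intro S g hg B hB
  have := congrArg (pairingHom.flip (B.dualPoly s)) hg
  rw [map_sum, map_zero, Finset.sum_eq_single B] at this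
  · simpa [pairingHom_apply, ListBasis.pairing_self] using this
  · intro D _ hD
    rw [map_smul, LinearMap.flip_apply, pairingHom_apply, B.pairing_of_ne hD, smul_zero]
  · exact fun h => absurd hB h

instance : Finite (ListBasis r X) :=
  Finite.of_injective (fun B => B.idx) fun _ _ h => ListBasis.ext_idx h

/-- Let `g` be the combination with coefficients `⟨Q_B, f⟩`. Then `f - g` pairs to zero with `P(X)`
by duality and with `J(X)` by membership in `D(X)`, hence with every polynomial. -/
theorem span_dualPoly (hX : Submodule.span ℝ (Set.range X) = ⊤) :
    Submodule.span ℝ (Set.range fun B : ListBasis r X => B.dualPoly s) = spaceD s X := by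
  classical
  have := Fintype.ofFinite (ListBasis r X)
  apply le_antisymm
  · rw [Submodule.span_le]
    rintro _ ⟨B, rfl⟩
    exact B.dualPoly_mem_spaceD
  · intro f hf
    let g := ∑ B : ListBasis r X, pairing (polyQ s X B) f • B.dualPoly s
    have hg : g ∈ Submodule.span ℝ (Set.range fun B : ListBasis r X => B.dualPoly s) :=
      Submodule.sum_mem _ fun B _ => Submodule.smul_mem _ _ (Submodule.subset_span ⟨B, rfl⟩)
    have hgD : g ∈ spaceD s X :=
      Submodule.sum_mem _ fun B _ => Submodule.smul_mem _ _ B.dualPoly_mem_spaceD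
    have hker : (⊤ : Submodule ℝ (MvPolynomial (Fin r) ℝ)) ≤
        LinearMap.ker (pairingHom.flip (f - g)) := by
      rw [← spaceP_sup_cocircuitIdeal s hX, sup_le_iff, ← span_polyQ, Submodule.span_le]
      constructor
      · rintro _ ⟨B, rfl⟩
        rw [SetLike.mem_coe, LinearMap.mem_ker, LinearMap.flip_apply, map_sub, map_sum,
          Finset.sum_eq_single B]
        · simp [pairingHom_apply, ListBasis.pairing_self]
        · intro D _ hD
          rw [map_smul, pairingHom_apply, D.pairing_of_ne hD.symm, smul_zero]
        · simp
      · intro q hq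
        exact (sub_mem hf hgD : f - g ∈ spaceD s X) q hq
    have : f - g = 0 := eq_zero_of_pairing fun p => hker (Submodule.mem_top (x := p))
    rw [sub_eq_zero.1 this]
    exact hg

end BasisPolynomial
-- Distributions given by measures, and their convolutions
/-- Pairs of sets on which the addition is a proper map. -/
def ProperPair {U : Type*} [NormedAddCommGroup U] (F G : Set U) : Prop :=
  ∀ R : ℝ, ∃ R' : ℝ, ∀ x ∈ F, ∀ z ∈ G, ‖x + z‖ ≤ R → ‖x‖ ≤ R' ∧ ‖z‖ ≤ R'

section MeasureDistributions

open MeasureTheory Distribution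

open scoped Manifold ContDiff

variable {U : Type*} [NormedAddCommGroup U] [NormedSpace ℝ U]

/-- The test function given by a smooth function with compact support. -/
def mkTest (f : U → ℝ) (hf : ContDiff ℝ ∞ f) (hc : HasCompactSupport f) : Test U where
  toFun := f
  contDiff' := hf
  hasCompactSupport' := hc
  tsupport_subset' := fun _ _ => trivial

@[simp]
theorem mkTest_apply (f : U → ℝ) (hf : ContDiff ℝ ∞ f) (hc : HasCompactSupport f) (u : U) :
    mkTest f hf hc u = f u := rfl

@[simp]
theorem translate_apply (ξ : U) (φ : Test U) (u : U) : translate ξ φ u = φ (ξ + u) := rfl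

theorem tsupport_translate_subset (ξ : U) (φ : Test U) :
    tsupport (translate ξ φ) ⊆ (fun u => ξ + u) ⁻¹' tsupport φ := by
  refine closure_minimal (fun u hu => ?_) ((isClosed_tsupport φ).preimage (by fun_prop))
  exact subset_tsupport _ hu

/-- A distribution vanishes on the test functions supported off its support. -/
theorem apply_eq_zero_of_disjoint_dsupport [FiniteDimensional ℝ U] (T : Distr U) (φ : Test U)
    (h : Disjoint (tsupport φ) (dsupport T)) : T φ = 0 := by
  have hcov : ∀ x : tsupport φ, ∃ V : Set U, IsOpen V ∧ x.1 ∈ V ∧ IsVanishingOn T V := by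
    intro x
    obtain ⟨V, h1, h2, h3⟩ := (notMem_dsupport_iff (f := T) x.1).1
      (Set.disjoint_left.1 h x.2)
    exact ⟨V, h2, h3, h1⟩
  choose V hVo hxV hV using hcov
  have hK : IsCompact (tsupport φ) := φ.hasCompactSupport
  obtain ⟨t, ht⟩ := hK.elim_finite_subcover V hVo fun x hx => Set.mem_iUnion.2 ⟨⟨x, hx⟩, hxV _⟩
  -- A partition of unity cuts `φ` into finitely many pieces, each supported where `T` is known to
  -- vanish.
  obtain ⟨p, hp⟩ := SmoothPartitionOfUnity.exists_isSubordinate 𝓘(ℝ, U) (isClosed_tsupport φ)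
    (fun i : t => V i) (fun i => hVo i) (by simpa [Set.iUnion_subtype] using ht)
  let ψ : t → Test U := fun i => mkTest (fun x => p i x * φ x)
    ((p i).contMDiff.contDiff.mul φ.contDiff) (φ.hasCompactSupport.mul_left)
  have hsum : φ = ∑ i, ψ i := by
    ext x
    have hs : (∑ i, ψ i) x = ∑ i, ψ i x := map_sum (delta x : Distr U) ψ Finset.univ
    rw [hs]
    simp only [ψ, mkTest_apply, ← Finset.sum_mul]
    by_cases hx : x ∈ tsupport φ
    · have := p.sum_eq_one hx
      rw [finsum_eq_sum_of_fintype] at this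
      rw [this, one_mul]
    · rw [image_eq_zero_of_notMem_tsupport hx, mul_zero]
  rw [hsum, map_sum]
  refine Finset.sum_eq_zero fun i _ => hV i (ψ i) ?_
  exact (closure_mono (Function.support_mul_subset_left _ _)).trans (hp i)

theorem exists_test_eq_one [FiniteDimensional ℝ U] {K : Set U} (hK : IsCompact K) :
    ∃ α : Test U, ∀ᶠ ξ in 𝓝ˢ K, α ξ = 1 := by
  obtain ⟨R, hR⟩ := hK.isBounded.subset_ball 0
  obtain ⟨f, hf1, hf2, -⟩ := exists_contMDiffMap_one_nhds_of_subset_interior 𝓘(ℝ, U)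
    (n := (⊤ : ℕ∞)) (s := K) (t := Metric.closedBall 0 R) hK.isClosed
    (hR.trans Metric.ball_subset_interior_closedBall)
  refine ⟨mkTest f f.contMDiff.contDiff ?_, hf1⟩
  exact HasCompactSupport.intro (isCompact_closedBall 0 R) fun x hx => hf2 x hx

/-- The compactness clause, applied to the support of `φ`, supplies a cutoff `α`. For a fixed `α`
the inner test function is determined pointwise, and so is the value. -/
theorem IsConvolution.unique [FiniteDimensional ℝ U] {S T R R' : Distr U}
    (h : IsConvolution S T R) (h' : IsConvolution S T R') : R = R' := by
  ext φ
  obtain ⟨α, hα⟩ := exists_test_eq_one (h.1 _ φ.hasCompactSupport)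
  obtain ⟨ψ, hψ, hR⟩ := h.2 φ α hα
  obtain ⟨ψ', hψ', hR'⟩ := h'.2 φ α hα
  have : ψ = ψ' := by
    ext ξ
    rw [hψ, hψ']
  rw [hR, hR', this]

theorem ProperPair.isCompact_inter [FiniteDimensional ℝ U] {F G : Set U} (h : ProperPair F G)
    {F' G' : Set U} (hF' : IsClosed F') (hG' : IsClosed G') (hF : F' ⊆ F) (hG : G' ⊆ G)
    {K : Set U} (hK : IsCompact K) : IsCompact (F' ∩ (K - G')) := by
  have : ProperSpace U := FiniteDimensional.proper_real U
  refine Metric.isCompact_of_isClosed_isBounded ?_ ?_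
  · refine hF'.inter ?_
    rw [sub_eq_add_neg]
    exact hG'.neg.add_left_of_isCompact hK
  · obtain ⟨R, hR⟩ := hK.isBounded.subset_closedBall 0
    obtain ⟨R', hR'⟩ := h R
    refine Metric.isBounded_closedBall.subset (t := Metric.closedBall 0 R') ?_
    rintro x ⟨hx, k, hk, z, hz, rfl⟩
    have := (hR' _ (hF hx) z (hG hz) (by simpa using hR hk)).1
    simpa using this

variable [FiniteDimensional ℝ U] [MeasurableSpace U] [BorelSpace U]

/-- The distribution `φ ↦ ∫ φ f dμ`. -/
noncomputable def measDistr (μ : Measure U) (f : U → ℝ) : Distr U :=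
  (TestFunction.integralAgainstBilinCLM (ContinuousLinearMap.mul ℝ ℝ) μ f : Test U →L[ℝ] ℝ)

theorem measDistr_apply (μ : Measure U) [IsFiniteMeasureOnCompacts μ] {f : U → ℝ}
    (hf : Continuous f) (φ : Test U) : measDistr μ f φ = ∫ u, φ u * f u ∂μ :=
  TestFunction.integralAgainstBilinCLM_eq_integral (n := ⊤)
    (Ω := (⊤ : TopologicalSpace.Opens U)) (B := ContinuousLinearMap.mul ℝ ℝ)
    (μ := μ) (f := φ) (hf.locallyIntegrable.locallyIntegrableOn _)

theorem measDistr_one_apply (μ : Measure U) [IsFiniteMeasureOnCompacts μ] (φ : Test U) :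
    measDistr μ (fun _ => 1) φ = ∫ u, φ u ∂μ := by
  rw [measDistr_apply μ continuous_const]
  simp

/-- After reflecting `φ` and the variable, this is the convolution of the constant `1` with a smooth
compactly supported function. -/
theorem contDiff_integral_translate (μ : Measure U) [IsFiniteMeasureOnCompacts μ]
    {φ : U → ℝ} (hφ : ContDiff ℝ ∞ φ) (hc : HasCompactSupport φ) :
    ContDiff ℝ ∞ fun ξ => ∫ z, φ (ξ + z) ∂μ := by
  have h1 : HasCompactSupport fun x => φ (-x) := hc.comp_homeomorph (Homeomorph.neg U)
  have h2 : ContDiff ℝ ∞ fun x => φ (-x) := hφ.comp contDiff_neg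
  have := (h1.contDiff_convolution_right (ContinuousLinearMap.mul ℝ ℝ) (μ := μ)
    (f := fun _ => (1 : ℝ)) continuous_const.locallyIntegrable h2).comp contDiff_neg
  convert this using 2 with ξ
  simp only [convolution, ContinuousLinearMap.mul_apply', one_mul, Function.comp_apply]
  congr 1
  ext z
  congr 1
  abel

/-- Criterion for a distribution to be a convolution of a measure with a density and another
distribution. -/
theorem isConvolution_measDistr {F G : Set U} (hFG : ProperPair F G) (hF : IsClosed F)
    (hG : IsClosed G) {μ : Measure U} [IsFiniteMeasureOnCompacts μ] {f : U → ℝ}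
    (hf : Continuous f) (hμF : ∀ᵐ x ∂μ, x ∈ F) {T R : Distr U}
    (hTG : ∀ φ : Test U, (∀ u ∈ G, φ u = 0) → T φ = 0)
    (hT : ∀ φ : Test U, ContDiff ℝ ∞ fun ξ => T (translate ξ φ))
    (hR : ∀ φ : Test U, R φ = ∫ ξ, T (translate ξ φ) * f ξ ∂μ) :
    IsConvolution (measDistr μ f) T R := by
  have hSF : dsupport (measDistr μ f) ⊆ F := by
    refine Set.sInter_subset_of_mem ⟨fun φ hφ => ?_, hF⟩
    rw [measDistr_apply μ hf, integral_eq_zero_of_ae]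
    filter_upwards [hμF] with x hx
    rw [image_eq_zero_of_notMem_tsupport fun h => hφ h hx, zero_mul]
    rfl
  have hTG' : dsupport T ⊆ G := by
    refine Set.sInter_subset_of_mem ⟨fun φ hφ => hTG φ fun u hu => ?_, hG⟩
    exact image_eq_zero_of_notMem_tsupport fun h => hφ h hu
  refine ⟨fun K hK => hFG.isCompact_inter isClosed_dsupport isClosed_dsupport hSF hTG' hK,
    fun φ α hα => ?_⟩
  have hα' := Filter.Eventually.self_of_nhdsSet hα
  refine ⟨mkTest (fun ξ => α ξ * T (translate ξ φ)) (α.contDiff.mul (hT φ))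
    (α.hasCompactSupport.mul_right), fun ξ => ?_, ?_⟩
  · rw [mkTest_apply, map_smul, smul_eq_mul]
  · have hae : ∀ᵐ x ∂μ, x ∈ (dsupport (measDistr μ f))ᶜ → f x = 0 := by
      refine IsOpen.ae_eq_zero_of_integral_contDiff_smul_eq_zero
        isClosed_dsupport.isOpen_compl (hf.locallyIntegrable.locallyIntegrableOn _)
        fun g hg hgc hgs => ?_
      have := apply_eq_zero_of_disjoint_dsupport (measDistr μ f) (mkTest g hg hgc)
        (Set.disjoint_left.2 fun x hx => hgs hx)
      rwa [measDistr_apply μ hf] at this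
    rw [hR, measDistr_apply μ hf]
    refine integral_congr_ae ?_
    filter_upwards [hae] with ξ hξ
    rw [mkTest_apply]
    by_cases h1 : ξ ∈ dsupport (measDistr μ f)
    · by_cases h2 : ξ ∈ tsupport φ - dsupport T
      · rw [hα' ξ ⟨h1, h2⟩, one_mul]
      · rw [apply_eq_zero_of_disjoint_dsupport T (translate ξ φ), mul_zero]
        refine Set.disjoint_left.2 fun u hu hu' => h2 ?_
        exact ⟨ξ + u, tsupport_translate_subset ξ φ hu, u, hu', by simp⟩
    · rw [hξ h1, mul_zero, mul_zero]

/-- A continuous function whose support in a set of full measure is bounded is integrable. -/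
theorem integrable_of_bounded {E : Type*} [NormedAddCommGroup E] [MeasurableSpace E]
    [BorelSpace E] [ProperSpace E] {μ : Measure E} [IsFiniteMeasureOnCompacts μ] {f : E → ℝ}
    (hf : Continuous f) {F : Set E} (hF : ∀ᵐ x ∂μ, x ∈ F) {R : ℝ}
    (h : ∀ x ∈ F, f x ≠ 0 → ‖x‖ ≤ R) : Integrable f μ := by
  have h1 : IntegrableOn f (Metric.closedBall 0 R) μ :=
    hf.continuousOn.integrableOn_compact (isCompact_closedBall 0 R)
  rw [← integrable_indicator_iff Metric.isClosed_closedBall.measurableSet] at h1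
  refine h1.congr ?_
  filter_upwards [hF] with x hx
  by_cases hxR : x ∈ Metric.closedBall (0 : E) R
  · rw [Set.indicator_of_mem hxR]
  · rw [Set.indicator_of_notMem hxR]
    by_contra h0
    exact hxR (by simpa using h x hx (Ne.symm h0))

theorem ae_prod_mem {A B : Type*} [MeasurableSpace A] [MeasurableSpace B] {μ : Measure A}
    {ν : Measure B} [SFinite ν] {F : Set A} {G : Set B} (hF : ∀ᵐ x ∂μ, x ∈ F)
    (hG : ∀ᵐ x ∂ν, x ∈ G) : ∀ᵐ p ∂μ.prod ν, p ∈ F ×ˢ G := by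
  filter_upwards [Measure.quasiMeasurePreserving_fst.ae hF,
    Measure.quasiMeasurePreserving_snd.ae hG] with p h1 h2
  exact ⟨h1, h2⟩

theorem integrable_prod_translate {F G : Set U} (hFG : ProperPair F G) {μ ν : Measure U}
    [IsFiniteMeasureOnCompacts μ] [IsFiniteMeasureOnCompacts ν] (hF : ∀ᵐ x ∂μ, x ∈ F)
    (hG : ∀ᵐ x ∂ν, x ∈ G) {f φ : U → ℝ} (hf : Continuous f) (hφ : Continuous φ)
    (hc : HasCompactSupport φ) :
    Integrable (fun p : U × U => f p.1 * φ (p.1 + p.2)) (μ.prod ν) := by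
  have : ProperSpace U := FiniteDimensional.proper_real U
  obtain ⟨R, hR⟩ := hc.isCompact.isBounded.subset_closedBall 0
  obtain ⟨R', hR'⟩ := hFG R
  refine integrable_of_bounded (by fun_prop) (ae_prod_mem hF hG) (R := R') ?_
  rintro ⟨x, z⟩ ⟨hx, hz⟩ hne
  have := hR' x hx z hz (by simpa using hR (subset_tsupport _ (right_ne_zero_of_mul hne)))
  exact max_le this.1 this.2

theorem isFiniteMeasureOnCompacts_conv {F G : Set U} (hFG : ProperPair F G) {μ ν : Measure U}
    [IsFiniteMeasureOnCompacts μ] [IsFiniteMeasureOnCompacts ν] (hF : ∀ᵐ x ∂μ, x ∈ F)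
    (hG : ∀ᵐ x ∂ν, x ∈ G) : IsFiniteMeasureOnCompacts (μ ∗ ν) := by
  have : ProperSpace U := FiniteDimensional.proper_real U
  refine ⟨fun K hK => ?_⟩
  obtain ⟨R, hR⟩ := hK.isBounded.subset_closedBall 0
  obtain ⟨R', hR'⟩ := hFG R
  rw [Measure.conv, Measure.map_apply (by fun_prop) hK.measurableSet]
  refine lt_of_le_of_lt (measure_mono_ae ?_) (isCompact_closedBall (0 : U × U) R').measure_lt_top
  filter_upwards [ae_prod_mem hF hG] with p hp hpK
  have := hR' _ hp.1 _ hp.2 (by simpa using hR hpK)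
  exact mem_closedBall_zero_iff.2 (max_le this.1 this.2)

end MeasureDistributions
-- Splines as convolutions of rays
theorem IsSpline.unique {U : Type*} [NormedAddCommGroup U] [NormedSpace ℝ U] {ι : Type*}
    [Fintype ι] {Y : ι → U} {T T' : Distr U} (h : IsSpline Y T) (h' : IsSpline Y T') :
    T = T' := by
  ext φ
  rw [(h φ).2, (h' φ).2]

section PushforwardMeasures

open MeasureTheory

variable {U : Type*} [NormedAddCommGroup U] [NormedSpace ℝ U] [FiniteDimensional ℝ U]
  [MeasurableSpace U] [BorelSpace U]

/-- The image of a measure on the real line under `c ↦ c • y`. -/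
noncomputable def lineMeasure (m : Measure ℝ) (y : U) : Measure U := m.map fun c => c • y

instance (m : Measure ℝ) [SFinite m] (y : U) : SFinite (lineMeasure m y) := by
  unfold lineMeasure; infer_instance

/-- The image of a product measure on `ℝ^ι` under `c ↦ ∑ i, c i • Y i`. -/
noncomputable def pushPi {ι : Type*} [Fintype ι] (m : Measure ℝ) (Y : ι → U) : Measure U :=
  (Measure.pi fun _ : ι => m).map fun c => ∑ i, c i • Y i

/-- The convolution of the images of `m` under `c ↦ c • y`, for the vectors of a list. -/
noncomputable def convList (m : Measure ℝ) : List U → Measure U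
  | [] => Measure.dirac 0
  | y :: l => lineMeasure m y ∗ convList m l

instance (m : Measure ℝ) [SFinite m] (l : List U) : SFinite (convList m l) := by
  induction l with
  | nil => unfold convList; infer_instance
  | cons y l ih => unfold convList; infer_instance

theorem convList_perm (m : Measure ℝ) [SFinite m] {l l' : List U} (h : l.Perm l') :
    convList m l = convList m l' := by
  induction h with
  | nil => rfl
  | cons x _ ih => rw [convList, convList, ih]
  | swap x y l =>
    simp only [convList]
    rw [← Measure.conv_assoc, ← Measure.conv_assoc, Measure.conv_comm (lineMeasure m y)]
  | trans _ _ h1 h2 => rw [h1, h2]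

theorem convList_append (m : Measure ℝ) [SFinite m] (l l' : List U) :
    convList m (l ++ l') = convList m l ∗ convList m l' := by
  induction l with
  | nil => simp only [List.nil_append, convList, Measure.dirac_zero_conv]
  | cons y l ih => simp only [List.cons_append, convList, ih, Measure.conv_assoc]

theorem pushPi_equiv {ι κ : Type*} [Fintype ι] [Fintype κ] (m : Measure ℝ) [SigmaFinite m]
    (e : ι ≃ κ) (Y : κ → U) : pushPi m (fun i => Y (e i)) = pushPi m Y := by
  unfold pushPi
  have h := (measurePreserving_piCongrLeft (fun _ : κ => m) e).map_eq
  have hc : (fun c : ι → ℝ => ∑ i, c i • Y (e i)) =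
      (fun c : κ → ℝ => ∑ i, c i • Y i) ∘ MeasurableEquiv.piCongrLeft (fun _ : κ => ℝ) e := by
    ext c
    rw [Function.comp_apply, ← e.sum_comp]
    refine Finset.sum_congr rfl fun i _ => ?_
    rw [MeasurableEquiv.coe_piCongrLeft, Equiv.piCongrLeft_apply_apply]
  rw [hc, ← h, Measure.map_map (by fun_prop) (by fun_prop)]

instance {ι : Type*} [Fintype ι] (m : Measure ℝ) [SigmaFinite m] (Y : ι → U) :
    SFinite (pushPi m Y) := by
  unfold pushPi; infer_instance

theorem pushPi_option {ι : Type*} [Fintype ι] (m : Measure ℝ) [SigmaFinite m]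
    (Y : Option ι → U) :
    pushPi m Y = lineMeasure m (Y none) ∗ pushPi m fun i => Y (some i) := by
  rw [Measure.conv_comm]
  unfold pushPi lineMeasure Measure.conv
  rw [Measure.map_prod_map _ _ (by fun_prop) (by fun_prop),
    Measure.map_map (by fun_prop) (by fun_prop), ← Measure.pi_map_piOptionEquivProd fun _ => m,
    Measure.map_map (by fun_prop) (by fun_prop)]
  congr 1
  ext c
  simp only [Function.comp_apply, Fintype.sum_option, Prod.map]
  rw [add_comm]
  rfl

theorem pushPi_of_isEmpty {ι : Type*} [Fintype ι] [IsEmpty ι] (m : Measure ℝ) (Y : ι → U) :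
    pushPi m Y = Measure.dirac 0 := by
  unfold pushPi
  rw [Measure.pi_of_empty, Measure.map_dirac' (by fun_prop)]
  simp

/-- Turns the orthant integral of a spline into an iterated convolution of rays, where order is
immaterial and rays can be integrated one at a time. -/
theorem pushPi_finset {E : Type*} (m : Measure ℝ) [SigmaFinite m] (S : Finset E)
    (y : E → U) : pushPi m (fun e : S => y e) = convList m (S.toList.map y) := by
  classical
  induction S using Finset.induction_on with
  | empty => rw [pushPi_of_isEmpty]; simp [convList]
  | insert a S ha ih =>
    rw [convList_perm m ((Finset.toList_insert ha).map y), List.map_cons, convList, ← ih,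
      ← pushPi_equiv m (Finset.subtypeInsertEquivOption ha).symm, pushPi_option]
    rfl

/-- Lebesgue measure on the half-line. -/
noncomputable abbrev halfLine : Measure ℝ := volume.restrict (Set.Ici 0)

theorem pi_halfLine {ι : Type*} [Fintype ι] : (Measure.pi fun _ : ι => halfLine) =
    volume.restrict {c : ι → ℝ | ∀ i, 0 ≤ c i} := by
  rw [volume_pi, ← Measure.restrict_pi_pi]
  · congr 1
    ext c
    simp [Pi.le_def]

theorem measDistr_isSpline {ι : Type*} [Fintype ι] (Y : ι → U)
    [IsFiniteMeasureOnCompacts (pushPi halfLine Y)] :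
    IsSpline Y (measDistr (pushPi halfLine Y) fun _ => 1) := by
  have : ProperSpace U := FiniteDimensional.proper_real U
  intro φ
  have hm : AEStronglyMeasurable φ
      ((Measure.pi fun _ : ι => halfLine).map fun c => ∑ i, c i • Y i) :=
    φ.continuous.aestronglyMeasurable
  have hmeas : Measurable fun c : ι → ℝ => ∑ i, c i • Y i := by fun_prop
  constructor
  · have h := φ.continuous.integrable_of_hasCompactSupport φ.hasCompactSupport
      (μ := pushPi halfLine Y)
    rw [pushPi, integrable_map_measure hm hmeas.aemeasurable, pi_halfLine] at h
    exact h
  · rw [measDistr_one_apply, pushPi, integral_map hmeas.aemeasurable hm, pi_halfLine]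

end PushforwardMeasures

/-! ### Cones and properness of addition -/

section Cones

open MeasureTheory

variable {U : Type*} [NormedAddCommGroup U] [NormedSpace ℝ U]

/-- A closed convex cone in the half-space `ω ≥ 0` that is thin near its apex. -/
def coneSet (ω : U →ₗ[ℝ] ℝ) (C : ℝ) : Set U := {z | ‖z‖ ≤ C * ω z}

variable {ω : U →ₗ[ℝ] ℝ} {C : ℝ}

theorem zero_mem_coneSet : (0 : U) ∈ coneSet ω C := by simp [coneSet]

theorem add_mem_coneSet {x z : U} (hx : x ∈ coneSet ω C) (hz : z ∈ coneSet ω C) :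
    x + z ∈ coneSet ω C := by
  simp only [coneSet, Set.mem_ofPred_eq, map_add] at *
  linarith [norm_add_le x z]

theorem smul_mem_coneSet {x : U} (hx : x ∈ coneSet ω C) {c : ℝ} (hc : 0 ≤ c) :
    c • x ∈ coneSet ω C := by
  simp only [coneSet, Set.mem_ofPred_eq, map_smul, norm_smul, Real.norm_eq_abs, abs_of_nonneg hc,
    smul_eq_mul] at *
  nlinarith

theorem nonneg_of_mem_coneSet {x : U} (hC : 0 < C) (hx : x ∈ coneSet ω C) : 0 ≤ ω x :=
  nonneg_of_mul_nonneg_right ((norm_nonneg x).trans hx) hC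

theorem exists_mem_coneSet (A : Finset U) (hA : ∀ y ∈ A, 0 < ω y) :
    ∃ C, 0 < C ∧ ∀ y ∈ A, y ∈ coneSet ω C := by
  -- The sum dominates each ratio; the summand `1` keeps the constant positive when `A` is empty.
  refine ⟨1 + ∑ y ∈ A, ‖y‖ / ω y, ?_, fun y hy => ?_⟩
  · have : 0 ≤ ∑ y ∈ A, ‖y‖ / ω y :=
      Finset.sum_nonneg fun y hy => div_nonneg (norm_nonneg y) (hA y hy).le
    linarith
  · have h1 : ‖y‖ / ω y ≤ ∑ y ∈ A, ‖y‖ / ω y :=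
      Finset.single_le_sum (f := fun y => ‖y‖ / ω y)
        (fun y hy => div_nonneg (norm_nonneg y) (hA y hy).le) hy
    have h2 := hA y hy
    have h3 : ‖y‖ = ‖y‖ / ω y * ω y := by field_simp
    change ‖y‖ ≤ _
    rw [h3]
    exact mul_le_mul_of_nonneg_right (by linarith) h2.le

variable [FiniteDimensional ℝ U]

theorem exists_bound (ω : U →ₗ[ℝ] ℝ) : ∃ M, 0 ≤ M ∧ ∀ x, |ω x| ≤ M * ‖x‖ :=
  ⟨‖LinearMap.toContinuousLinearMap ω‖, norm_nonneg _,
    fun x => (LinearMap.toContinuousLinearMap ω).le_opNorm x⟩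

theorem continuous_functional (ω : U →ₗ[ℝ] ℝ) : Continuous ω :=
  ω.continuous_of_finiteDimensional

theorem isClosed_coneSet : IsClosed (coneSet ω C) :=
  isClosed_le continuous_norm (continuous_const.mul (continuous_functional ω))

/-- On the cone `ω` is nonnegative and controls the norm, so a bound on `ω x + ω z` bounds both
vectors. -/
theorem properPair_coneSet (hC : 0 < C) : ProperPair (coneSet ω C) (coneSet ω C) := by
  obtain ⟨M, hM, hω⟩ := exists_bound ω
  intro R
  refine ⟨C * (M * R), fun x hx z hz h => ?_⟩
  have h1 := nonneg_of_mem_coneSet hC hx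
  have h2 := nonneg_of_mem_coneSet hC hz
  have h3 : ω x + ω z ≤ M * R := by
    rw [← map_add]
    exact (le_abs_self _).trans ((hω _).trans (mul_le_mul_of_nonneg_left h hM))
  exact ⟨le_trans hx (mul_le_mul_of_nonneg_left (by linarith) hC.le),
    le_trans hz (mul_le_mul_of_nonneg_left (by linarith) hC.le)⟩

/-- Here `ω (x + z) = ω z`, which bounds `z` on either cone, and then `x` by subtraction. Both cones
are needed because `R_k` has a part on each side of `S_{k-1}`. -/
theorem properPair_ker (hC : 0 < C) :
    ProperPair {x | ω x = 0} (coneSet ω C ∪ coneSet (-ω) C) := by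
  obtain ⟨M, hM, hω⟩ := exists_bound ω
  intro R
  refine ⟨R + C * (M * R), fun x hx z hz h => ?_⟩
  have hR : 0 ≤ R := (norm_nonneg _).trans h
  have hz0 : |ω z| ≤ M * R := by
    have : ω (x + z) = ω z := by rw [map_add, show ω x = 0 from hx, zero_add]
    rw [← this]
    exact (hω _).trans (mul_le_mul_of_nonneg_left h hM)
  have hz1 : ‖z‖ ≤ C * (M * R) := by
    rcases hz with hz | hz
    · exact le_trans hz (mul_le_mul_of_nonneg_left ((le_abs_self _).trans hz0) hC.le)
    · exact le_trans hz (mul_le_mul_of_nonneg_left ((neg_le_abs _).trans hz0) hC.le)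
  refine ⟨?_, by linarith⟩
  calc ‖x‖ = ‖x + z - z‖ := by rw [add_sub_cancel_right]
    _ ≤ ‖x + z‖ + ‖z‖ := norm_sub_le _ _
    _ ≤ _ := by linarith

variable [MeasurableSpace U] [BorelSpace U]

/-- A locally finite measure concentrated on the cone `coneSet ω C`. -/
structure ConeMeasure (ω : U →ₗ[ℝ] ℝ) (C : ℝ) (μ : Measure U) : Prop where
  finite : IsFiniteMeasureOnCompacts μ
  ae_mem : ∀ᵐ x ∂μ, x ∈ coneSet ω C

theorem ConeMeasure.dirac_zero : ConeMeasure ω C (Measure.dirac 0) where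
  finite := inferInstance
  ae_mem := by
    rw [ae_dirac_iff (p := (· ∈ coneSet ω C)) isClosed_coneSet.measurableSet]
    exact zero_mem_coneSet

theorem ConeMeasure.conv {μ ν : Measure U} (hC : 0 < C) (hμ : ConeMeasure ω C μ)
    (hν : ConeMeasure ω C ν) : ConeMeasure ω C (μ ∗ ν) where
  finite := by
    have := hμ.finite
    have := hν.finite
    exact isFiniteMeasureOnCompacts_conv (properPair_coneSet hC) hμ.ae_mem hν.ae_mem
  ae_mem := by
    have : ProperSpace U := FiniteDimensional.proper_real U
    have := hμ.finite
    have := hν.finite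
    rw [Measure.conv, ae_map_iff (p := (· ∈ coneSet ω C)) (by fun_prop) isClosed_coneSet.measurableSet]
    filter_upwards [ae_prod_mem hμ.ae_mem hν.ae_mem] with p hp
    exact add_mem_coneSet hp.1 hp.2

theorem ConeMeasure.ray {y : U} (hy : y ∈ coneSet ω C) (h0 : y ≠ 0) :
    ConeMeasure ω C (lineMeasure halfLine y) where
  finite := by
    refine ⟨fun K hK => ?_⟩
    obtain ⟨R, hR⟩ := hK.isBounded.subset_closedBall 0
    rw [lineMeasure, Measure.map_apply (by fun_prop) hK.measurableSet]
    refine lt_of_le_of_lt (measure_mono fun c hc => ?_)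
      (isCompact_closedBall (0 : ℝ) (R / ‖y‖)).measure_lt_top
    have : ‖c • y‖ ≤ R := by simpa using hR hc
    rw [norm_smul] at this
    rw [mem_closedBall_zero_iff, le_div_iff₀ (norm_pos_iff.2 h0)]
    exact this
  ae_mem := by
    rw [lineMeasure, ae_map_iff (p := (· ∈ coneSet ω C)) (by fun_prop) isClosed_coneSet.measurableSet]
    filter_upwards [ae_restrict_mem measurableSet_Ici] with c hc
    exact smul_mem_coneSet hy hc

theorem ConeMeasure.convList (hC : 0 < C) {l : List U}
    (hl : ∀ y ∈ l, y ∈ coneSet ω C ∧ y ≠ 0) : ConeMeasure ω C (convList halfLine l) := by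
  induction l with
  | nil => exact ConeMeasure.dirac_zero
  | cons y l ih =>
    exact (ConeMeasure.ray (hl y List.mem_cons_self).1 (hl y List.mem_cons_self).2).conv hC
      (ih fun y' hy' => hl y' (List.mem_cons_of_mem _ hy'))

end Cones
-- Integration along rays as iterated primitives
section Signs

variable {U : Type*} [NormedAddCommGroup U] [NormedSpace ℝ U] {r : ℕ}
  {s : Module.Basis (Fin r) ℝ U} {ω : U →ₗ[ℝ] ℝ}

theorem polyFun_add_smul_of_dirDeriv_eq_zero {g : MvPolynomial (Fin r) ℝ} {y : U}
    (h : dirDeriv s y g = 0) (u : U) (c : ℝ) : polyFun s g (u + c • y) = polyFun s g u := by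
  have hd : ∀ t, HasDerivAt (fun t : ℝ => polyFun s g (u + t • y)) 0 t := fun t => by
    simpa [h, polyFun_zero_poly] using hasDerivAt_polyFun s g u y t
  simpa using is_const_of_deriv_eq_zero (fun t => (hd t).differentiableAt)
    (fun t => (hd t).deriv) c 0

/-- The sign of `ω` on a vector, as a real number. -/
noncomputable def signOf (ω : U →ₗ[ℝ] ℝ) (v : U) : ℝ := by
  classical exact if 0 < ω v then 1 else -1

theorem signOf_mul_self (ω : U →ₗ[ℝ] ℝ) (v : U) : signOf ω v * signOf ω v = 1 := by
  unfold signOf; split_ifs <;> norm_num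

theorem pos_signOf_smul {ω : U →ₗ[ℝ] ℝ} {v : U} (h : ω v ≠ 0) : 0 < ω (signOf ω v • v) := by
  unfold signOf
  split_ifs with h'
  · simpa using h'
  · simpa using lt_of_le_of_ne (not_lt.1 h') h

theorem dirDeriv_smul_left (c : ℝ) (u : U) (f : MvPolynomial (Fin r) ℝ) :
    dirDeriv s (c • u) f = c • dirDeriv s u f := by
  simp [dirDeriv_apply, mul_smul, Finset.smul_sum]

/-- `c ↦ -h(u - c y)` is an antiderivative, and at the upper limit the point reaches the hyperplane,
where `h` is zero. -/
theorem integral_primitive {y : U} (hy : 0 < ω y) {g h : MvPolynomial (Fin r) ℝ}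
    (hD : dirDeriv s y h = g) (hv : VanishesOnKer s ω h) (u : U) :
    ∫ c in (0 : ℝ)..(ω u / ω y), polyFun s g (u - c • y) = polyFun s h u := by
  have hd : ∀ c : ℝ, HasDerivAt (fun c : ℝ => -polyFun s h (u - c • y))
      (polyFun s g (u - c • y)) c := by
    intro c
    have h1 := hasDerivAt_polyFun s h u (-y) c
    rw [dirDeriv_neg, hD, polyFun_neg] at h1
    simpa [sub_eq_add_neg] using h1.fun_neg
  rw [intervalIntegral.integral_eq_sub_of_hasDerivAt (fun c _ => hd c)]
  · rw [hv (u - (ω u / ω y) • y) (by simp [hy.ne'])]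
    simp
  · exact ((continuous_polyFun s g).comp (by fun_prop)).intervalIntegrable _ _

end Signs

section RayStep

open MeasureTheory

variable {U : Type*} [NormedAddCommGroup U] [NormedSpace ℝ U] [FiniteDimensional ℝ U]
  [MeasurableSpace U] [BorelSpace U] {r : ℕ} {s : Module.Basis (Fin r) ℝ U} {ω : U →ₗ[ℝ] ℝ}

/-- Integrating a polynomial density on a half-space along a ray yields the density given by a
primitive. -/
theorem integral_ray_step (κ : Measure U) [IsFiniteMeasureOnCompacts κ] {y : U}
    (hinv : ∀ c : ℝ, κ.map (fun u => u + c • y) = κ) (hy : 0 < ω y)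
    {g h : MvPolynomial (Fin r) ℝ} (hD : dirDeriv s y h = g) (hv : VanishesOnKer s ω h)
    {φ : U → ℝ} (hφ : Continuous φ) (hc : HasCompactSupport φ) :
    ∫ c in Set.Ici (0 : ℝ), (∫ u in {u | 0 ≤ ω u}, polyFun s g u * φ (c • y + u) ∂κ) =
      ∫ u in {u | 0 ≤ ω u}, polyFun s h u * φ u ∂κ := by
  have : ProperSpace U := FiniteDimensional.proper_real U
  have hω := continuous_functional ω
  have hgc := continuous_polyFun s g
  have hH : MeasurableSet {u : U | 0 ≤ ω u} := (isClosed_le continuous_const hω).measurableSet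
  -- The translate of the half-space by `c y`: the region of integration after substituting `u - c
  -- y` for `u`.
  let D : Set (ℝ × U) := {p | p.1 * ω y ≤ ω p.2}
  have hDc : IsClosed D := isClosed_le (by fun_prop) (by fun_prop)
  let F : ℝ × U → ℝ := fun p => polyFun s g (p.2 - p.1 • y) * φ p.2
  have hF : Continuous F := by fun_prop
  have h1 : ∀ c : ℝ, ∫ u in {u | 0 ≤ ω u}, polyFun s g u * φ (c • y + u) ∂κ =
      ∫ u, D.indicator F (c, u) ∂κ := by
    intro c
    rw [← integral_indicator hH]
    conv_lhs => rw [← hinv (-c)]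
    have hemb : MeasurableEmbedding fun u : U => u + (-c) • y :=
      (Homeomorph.addRight ((-c) • y)).measurableEmbedding
    rw [hemb.integral_map]
    congr 1
    ext u
    have hiff : u + (-c) • y ∈ {u : U | 0 ≤ ω u} ↔ (c, u) ∈ D := by
      simp only [D, Set.mem_ofPred_eq, map_add, map_smul, smul_eq_mul]
      constructor <;> intro h <;> linarith
    by_cases hu : (c, u) ∈ D
    · rw [Set.indicator_of_mem hu, Set.indicator_of_mem (hiff.2 hu)]
      simp only [F, neg_smul, ← sub_eq_add_neg, add_sub_cancel]
    · rw [Set.indicator_of_notMem hu, Set.indicator_of_notMem (mt hiff.1 hu)]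
  simp only [h1]
  have hint : Integrable (D.indicator F) (halfLine.prod κ) := by
    rw [integrable_indicator_iff hDc.measurableSet]
    obtain ⟨R, hR⟩ := hc.isCompact.isBounded.subset_closedBall 0
    obtain ⟨M, hM, hωM⟩ := exists_bound ω
    have hae : ∀ᵐ p ∂(halfLine.prod κ).restrict D, p ∈ (Set.Ici (0 : ℝ) ×ˢ Set.univ) ∩ D := by
      filter_upwards [ae_restrict_mem hDc.measurableSet, ae_restrict_of_ae (ae_prod_mem
        (ae_restrict_mem measurableSet_Ici : ∀ᵐ c ∂halfLine, c ∈ Set.Ici (0 : ℝ))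
        (Filter.Eventually.of_forall Set.mem_univ : ∀ᵐ u ∂κ, u ∈ Set.univ))] with p h1 h2
      exact ⟨h2, h1⟩
    refine integrable_of_bounded hF hae (R := max (M * R / ω y) R) ?_
    rintro ⟨c, u⟩ ⟨⟨hc0, -⟩, hcD⟩ hne
    have hu : ‖u‖ ≤ R := by simpa using hR (subset_tsupport _ (right_ne_zero_of_mul hne))
    refine max_le_max ?_ hu
    change ‖c‖ ≤ _
    rw [Real.norm_eq_abs, abs_of_nonneg hc0, le_div_iff₀ hy]
    exact hcD.trans ((le_abs_self _).trans ((hωM u).trans (mul_le_mul_of_nonneg_left hu hM)))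
  -- For fixed `u` the variable `c` then runs over `[0, ω u / ω y]`, exactly the interval in
  -- `integral_primitive`.
  rw [integral_integral_swap (f := fun c u => D.indicator F (c, u)) hint,
    ← integral_indicator hH]
  congr 1
  ext u
  by_cases hu : 0 ≤ ω u
  · rw [Set.indicator_of_mem (show u ∈ {u : U | 0 ≤ ω u} from hu)]
    have h2 : ∀ c : ℝ, D.indicator F (c, u) =
        (Set.Iic (ω u / ω y)).indicator (fun c => polyFun s g (u - c • y) * φ u) c := by
      intro c
      have hiff : (c, u) ∈ D ↔ c ∈ Set.Iic (ω u / ω y) := by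
        simp only [D, Set.mem_ofPred_eq, Set.mem_Iic, le_div_iff₀ hy]
      by_cases hcu : (c, u) ∈ D
      · rw [Set.indicator_of_mem hcu, Set.indicator_of_mem (hiff.1 hcu)]
      · rw [Set.indicator_of_notMem hcu, Set.indicator_of_notMem (mt hiff.2 hcu)]
    simp only [h2]
    rw [integral_indicator measurableSet_Iic, Measure.restrict_restrict measurableSet_Iic,
      Set.inter_comm, Set.Ici_inter_Iic, integral_Icc_eq_integral_Ioc,
      ← intervalIntegral.integral_of_le (div_nonneg hu hy.le),
      intervalIntegral.integral_mul_const, integral_primitive hy hD hv]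
  · rw [Set.indicator_of_notMem (show u ∉ {u : U | 0 ≤ ω u} from hu)]
    rw [setIntegral_congr_fun (g := fun _ => 0) measurableSet_Ici, integral_zero]
    intro c hc0
    refine Set.indicator_of_notMem (fun hcD => hu ?_) _
    exact (mul_nonneg hc0 hy.le).trans hcD

variable {N : ℕ} {X : Fin N → U}

/-- The convolution of a polynomial density on a hyperplane with the spline of a list of vectors
(oriented so that `ω` is positive) is given by the iterated primitives on the half-space `ω ≥ 0`. -/
theorem integral_convList {C : ℝ} (hC : 0 < C) {b : U} (hb : ω b = 1) (hbC : b ∈ coneSet ω C)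
    {ν κ : Measure U} [IsFiniteMeasureOnCompacts ν] [IsFiniteMeasureOnCompacts κ]
    (hν : ∀ᵐ x ∂ν, ω x = 0)
    (hκ : κ.restrict {u | 0 ≤ ω u} = ν ∗ lineMeasure halfLine b)
    {n : ℕ} {g : MvPolynomial (Fin r) ℝ} (hg : g.IsHomogeneous n) (hgb : dirDeriv s b g = 0)
    {l : List (Fin N)} (hl : ∀ e ∈ l, ω (X e) ≠ 0)
    (hlC : ∀ e ∈ l, signOf ω (X e) • X e ∈ coneSet ω C)
    (hinv : ∀ e ∈ l, ∀ c : ℝ, κ.map (fun u => u + c • X e) = κ) (φ : Test U) :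
    ∫ ξ, polyFun s g ξ * (∫ z, φ (ξ + z)
        ∂convList halfLine ((l.map fun e => signOf ω (X e) • X e) ++ [b])) ∂ν =
      (l.map fun e => signOf ω (X e)).prod *
        ∫ u in {u | 0 ≤ ω u}, polyFun s (primitives s ω X l g) u * φ u ∂κ := by
  have : ProperSpace U := FiniteDimensional.proper_real U
  have hb0 : b ≠ 0 := by rintro rfl; simp at hb
  have hgc := continuous_polyFun s g
  have hcone : ∀ l : List (Fin N), (∀ e ∈ l, ω (X e) ≠ 0) →
      (∀ e ∈ l, signOf ω (X e) • X e ∈ coneSet ω C) →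
      ConeMeasure ω C (convList halfLine ((l.map fun e => signOf ω (X e) • X e) ++ [b])) := by
    intro l hl hlC
    refine ConeMeasure.convList hC fun y hy => ?_
    rcases List.mem_append.1 hy with hy | hy
    · obtain ⟨e, he, rfl⟩ := List.mem_map.1 hy
      refine ⟨hlC e he, fun h0 => (pos_signOf_smul (hl e he)).ne' ?_⟩
      rw [h0, map_zero]
    · rw [List.mem_singleton.1 hy]
      exact ⟨hbC, hb0⟩
  -- The base case has only the ray of `b`, along which `g` is constant. Each further ray is peeled
  -- off by applying the hypothesis to translates of `φ`, hence the generalization.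
  induction l generalizing φ with
  | nil =>
    simp only [List.map_nil, List.nil_append, List.prod_nil, one_mul, convList,
      Measure.conv_dirac_zero, primitives, List.foldr_nil]
    have hfin : IsFiniteMeasureOnCompacts (ν ∗ lineMeasure halfLine b) := hκ ▸ inferInstance
    have hint : Integrable (fun u => polyFun s g u * φ u) (ν ∗ lineMeasure halfLine b) :=
      (hgc.mul φ.continuous).integrable_of_hasCompactSupport φ.hasCompactSupport.mul_left
    rw [hκ, integral_conv hint]
    congr 1
    ext ξ
    have hφc := φ.continuous
    rw [lineMeasure, integral_map (by fun_prop) (Continuous.aestronglyMeasurable (by fun_prop)),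
      integral_map (by fun_prop) (Continuous.aestronglyMeasurable (by fun_prop)),
      ← integral_const_mul]
    simp only [polyFun_add_smul_of_dirDeriv_eq_zero hgb]
  | cons e l ih =>
    have hl' : ∀ e ∈ l, ω (X e) ≠ 0 := fun e' h => hl e' (List.mem_cons_of_mem _ h)
    have hlC' : ∀ e ∈ l, signOf ω (X e) • X e ∈ coneSet ω C :=
      fun e' h => hlC e' (List.mem_cons_of_mem _ h)
    have hM := hcone l hl' hlC'
    have hM1 := hcone (e :: l) hl hlC
    have hyC := hlC e List.mem_cons_self
    have hy := pos_signOf_smul (hl e List.mem_cons_self)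
    have hY : ConeMeasure ω C (lineMeasure halfLine (signOf ω (X e) • X e)) :=
      ConeMeasure.ray hyC fun h => hy.ne' (by rw [h, map_zero])
    simp only [List.map_cons, List.cons_append, convList] at hM1 ⊢
    set M := convList halfLine ((l.map fun e => signOf ω (X e) • X e) ++ [b]) with hMdef
    set y := signOf ω (X e) • X e with hydef
    have := hM.finite
    have := hM1.finite
    have := hY.finite
    have hΦ : Continuous fun w => ∫ z, φ (w + z) ∂M :=
      (contDiff_integral_translate M φ.contDiff φ.hasCompactSupport).continuous
    have h1 : ∀ ξ, polyFun s g ξ * ∫ z, φ (ξ + z) ∂(lineMeasure halfLine y ∗ M) =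
        ∫ c in Set.Ici (0 : ℝ), polyFun s g ξ * ∫ z, φ ((ξ + c • y) + z) ∂M := by
      intro ξ
      have hi : Integrable (fun z => φ (ξ + z)) (lineMeasure halfLine y ∗ M) :=
        ((translate ξ φ).continuous.integrable_of_hasCompactSupport
          (translate ξ φ).hasCompactSupport)
      rw [integral_const_mul, integral_conv hi, lineMeasure, integral_map (by fun_prop)]
      · simp only [add_assoc]
      · simp only [← add_assoc]
        exact (hΦ.comp (continuous_const.add continuous_id)).aestronglyMeasurable
    simp only [h1]
    have hint : Integrable (fun p : U × ℝ => polyFun s g p.1 * ∫ z, φ ((p.1 + p.2 • y) + z) ∂M)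
        (ν.prod halfLine) := by
      obtain ⟨R, hR⟩ := φ.hasCompactSupport.isCompact.isBounded.subset_closedBall 0
      obtain ⟨R', hR'⟩ := properPair_ker (ω := ω) hC R
      obtain ⟨m, hm, hωm⟩ := exists_bound ω
      refine integrable_of_bounded (hgc.fst'.mul (hΦ.comp (by fun_prop)))
        (ae_prod_mem (F := {x | ω x = 0}) hν (ae_restrict_mem measurableSet_Ici))
        (R := max R' (m * R' / ω y)) ?_
      rintro ⟨ξ, c⟩ ⟨hξ, hc⟩ hne
      -- A nonzero inner integral provides a point `z` of the cone; properness bounds `ξ` and `c y +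
      -- z`, and positivity of `ω` on the cone then bounds `c`.
      obtain ⟨z, hz, hφz⟩ : ∃ z ∈ coneSet ω C, φ ((ξ + c • y) + z) ≠ 0 := by
        by_contra! h0
        refine right_ne_zero_of_mul hne (integral_eq_zero_of_ae ?_)
        filter_upwards [hM.ae_mem] with z hz
        exact h0 z hz
      have hcz : c • y + z ∈ coneSet ω C := add_mem_coneSet (smul_mem_coneSet hyC hc) hz
      rw [add_assoc] at hφz
      obtain ⟨hb1, hb2⟩ := hR' ξ hξ _ (Or.inl hcz) (by simpa using hR (subset_tsupport _ hφz))
      refine max_le_max hb1 ?_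
      change ‖c‖ ≤ _
      rw [Real.norm_eq_abs, abs_of_nonneg hc, le_div_iff₀ hy]
      have hz0 := nonneg_of_mem_coneSet hC hz
      have h2 : ω (c • y + z) ≤ m * R' :=
        (le_abs_self _).trans ((hωm _).trans (mul_le_mul_of_nonneg_left hb2 hm))
      rw [map_add, map_smul, smul_eq_mul] at h2
      linarith
    rw [integral_integral_swap
      (f := fun ξ c => polyFun s g ξ * ∫ z, φ ((ξ + c • y) + z) ∂M) hint]
    have hih : ∀ c : ℝ, ∫ ξ, polyFun s g ξ * (∫ z, φ ((ξ + c • y) + z) ∂M) ∂ν =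
        (l.map fun e => signOf ω (X e)).prod *
          ∫ u in {u | 0 ≤ ω u}, polyFun s (primitives s ω X l g) u * φ (c • y + u) ∂κ := by
      intro c
      have h2 := ih hl' hlC' (fun e' h => hinv e' (List.mem_cons_of_mem _ h))
        (translate (c • y) φ)
      simp only [translate_apply] at h2
      rw [← h2]
      congr 1
      ext ξ
      congr 2
      ext z
      congr 1
      abel
    simp only [hih]
    -- The primitive along `y = ±X e` is `±` the primitive along `X e`; this sign joins the product.
    rw [integral_const_mul, integral_ray_step κ (y := y)
      (h := signOf ω (X e) • primitive s ω (X e) (primitives s ω X l g)) _ hy _ _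
      φ.continuous φ.hasCompactSupport, List.prod_cons, primitives_cons]
    · simp only [polyFun_smul, mul_assoc, integral_const_mul]
      ring
    · intro c
      simpa [hydef, smul_smul] using hinv e List.mem_cons_self (c * signOf ω (X e))
    · rw [hydef, dirDeriv_smul_left, Derivation.map_smul, smul_smul, signOf_mul_self, one_smul,
        dirDeriv_primitive (isHomogeneous_primitives s hg ω l) (hl e List.mem_cons_self)]
    · intro u hu
      rw [polyFun_smul, vanishesOnKer_primitive _ _ u hu, mul_zero]

end RayStep
-- Lebesgue measure on the flag of a basis
section FlagMeasures

open MeasureTheory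

variable {U : Type*} [NormedAddCommGroup U] [NormedSpace ℝ U] [MeasurableSpace U]

namespace ListBasis

variable {N r : ℕ} {X : Fin N → U} (B : ListBasis r X)

/-- The Lebesgue measure on `S_k`, in the coordinates `b₁, …, b_k`. -/
noncomputable def flagMeasure (k : Fin (r + 1)) : Measure U :=
  convList volume ((Finset.univ.filter fun j : Fin r => j.castSucc < k).toList.map B.vec)

theorem flagMeasure_zero : B.flagMeasure 0 = Measure.dirac 0 := by
  simp [flagMeasure, convList]

end ListBasis

variable [BorelSpace U] {ω : U →ₗ[ℝ] ℝ}

theorem lineMeasure_volume (y : U) : lineMeasure volume y =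
    lineMeasure halfLine y + lineMeasure halfLine (-y) := by
  have h : lineMeasure halfLine (-y) =
      (volume.restrict (Set.Iio (0 : ℝ))).map fun c => c • y := by
    have h1 : (volume.restrict (Set.Iio (0 : ℝ))) = halfLine.map fun c => -c := by
      have := (Measure.measurePreserving_neg (volume : Measure ℝ)).restrict_preimage
        (measurableSet_Iic (a := (0 : ℝ)))
      rw [Measure.restrict_congr_set Iio_ae_eq_Iic, ← this.map_eq]
      congr 2
      ext c
      simp
    rw [h1, lineMeasure, Measure.map_map (by fun_prop) (by fun_prop)]
    congr 1
    ext c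
    simp
  rw [h, lineMeasure, lineMeasure, ← Measure.map_add _ _ (by fun_prop)]
  congr 1
  rw [← Set.compl_Ici, Measure.restrict_add_restrict_compl measurableSet_Ici]

theorem lineMeasure_volume_neg (y : U) : lineMeasure volume (-y) = lineMeasure volume y := by
  rw [lineMeasure_volume, lineMeasure_volume, neg_neg, add_comm]

theorem ae_lineMeasure {m : Measure ℝ} {y : U} {p : U → Prop} (hp : MeasurableSet {x | p x})
    (h : ∀ᵐ c ∂m, p (c • y)) : ∀ᵐ x ∂lineMeasure m y, p x := by
  rwa [lineMeasure, ae_map_iff (by fun_prop) hp]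

theorem isFiniteMeasureOnCompacts_lineMeasure {y : U} (hy : y ≠ 0) :
    IsFiniteMeasureOnCompacts (lineMeasure volume y) := by
  refine ⟨fun K hK => ?_⟩
  obtain ⟨R, hR⟩ := hK.isBounded.subset_closedBall 0
  rw [lineMeasure, Measure.map_apply (by fun_prop) hK.measurableSet]
  refine lt_of_le_of_lt (measure_mono fun c hc => ?_)
    (isCompact_closedBall (0 : ℝ) (R / ‖y‖)).measure_lt_top
  have : ‖c • y‖ ≤ R := by simpa using hR hc
  rw [norm_smul] at this
  rw [mem_closedBall_zero_iff, le_div_iff₀ (norm_pos_iff.2 hy)]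
  exact this

variable [FiniteDimensional ℝ U]

theorem ae_conv {μ ν : Measure U} [SFinite μ] [SFinite ν] {p q t : U → Prop}
    (ht : MeasurableSet {x | t x}) (hp : ∀ᵐ x ∂μ, p x) (hq : ∀ᵐ x ∂ν, q x)
    (h : ∀ x z, p x → q z → t (x + z)) : ∀ᵐ x ∂(μ ∗ ν), t x := by
  rw [Measure.conv, ae_map_iff (by fun_prop) ht]
  filter_upwards [ae_prod_mem (F := {x | p x}) (G := {x | q x}) hp hq] with x hx
  exact h _ _ hx.1 hx.2

theorem lineMeasure_conv_dirac (y : U) (c : ℝ) :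
    lineMeasure volume y ∗ Measure.dirac (c • y) = lineMeasure volume y := by
  rw [Measure.conv_dirac, lineMeasure, Measure.map_map (by fun_prop) (by fun_prop)]
  conv_rhs => rw [← map_add_right_eq_self volume c, Measure.map_map (by fun_prop) (by fun_prop)]
  congr 1
  ext d
  simp [add_smul]

/-- The line of `b` is the union of two opposite rays. As `ν` lives on `ω = 0`, one ray gives `ω ≥
0` and the other `ω < 0` up to a null set. -/
theorem restrict_lineMeasure_conv {ν : Measure U} [SFinite ν] {b : U} (hb : ω b = 1)
    (hν : ∀ᵐ x ∂ν, ω x = 0) : (lineMeasure volume b ∗ ν).restrict {u | 0 ≤ ω u} =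
      ν ∗ lineMeasure halfLine b := by
  have : ProperSpace U := FiniteDimensional.proper_real U
  have hω : Measurable ω := (continuous_functional ω).measurable
  have hH : MeasurableSet {u : U | 0 ≤ ω u} := measurableSet_le measurable_const hω
  rw [lineMeasure_volume, Measure.conv_comm, Measure.conv_add, Measure.restrict_add]
  have h1 : ∀ᵐ u ∂(ν ∗ lineMeasure halfLine b), u ∈ {u : U | 0 ≤ ω u} := by
    refine ae_conv hH hν (q := fun z => 0 ≤ ω z) (ae_lineMeasure hH ?_) fun x z hx hz => ?_
    · filter_upwards [ae_restrict_mem measurableSet_Ici] with c hc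
      simpa [hb] using hc
    · rw [Set.mem_ofPred_eq, map_add, hx, zero_add]; exact hz
  have h2 : ∀ᵐ u ∂(ν ∗ lineMeasure halfLine (-b)), u ∉ {u : U | 0 ≤ ω u} := by
    refine ae_conv hH.compl hν (q := fun z => ω z < 0)
      (ae_lineMeasure (measurableSet_lt hω measurable_const) ?_) fun x z hx hz => ?_
    · filter_upwards [ae_restrict_mem measurableSet_Ici,
        ae_restrict_of_ae (Measure.ae_ne volume (0 : ℝ))] with c hc hc0
      have : 0 < c := lt_of_le_of_ne hc (Ne.symm hc0)
      simpa [hb] using this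
    · rw [Set.mem_ofPred_eq, map_add, hx, zero_add]
      exact not_le.2 hz
  rw [Measure.restrict_eq_self_of_ae_mem h1]
  have h3 : (ν ∗ lineMeasure halfLine (-b)).restrict {u : U | 0 ≤ ω u} = 0 :=
    Measure.restrict_eq_zero.2 (by rw [measure_eq_zero_iff_ae_notMem]; exact h2)
  rw [h3, add_zero]

theorem restrict_neg_lineMeasure_conv {ν : Measure U} [SFinite ν] {b : U} (hb : ω b = 1)
    (hν : ∀ᵐ x ∂ν, ω x = 0) : (lineMeasure volume b ∗ ν).restrict {u | 0 ≤ (-ω) u} =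
      ν ∗ lineMeasure halfLine (-b) := by
  rw [← lineMeasure_volume_neg]
  exact restrict_lineMeasure_conv (ω := -ω) (by simp [hb]) (by simpa using hν)

theorem integral_lineMeasure_conv {ν : Measure U} [SFinite ν] {b : U} (hb : ω b = 1)
    (hν : ∀ᵐ x ∂ν, ω x = 0) {f : U → ℝ} (hf : Integrable f (lineMeasure volume b ∗ ν)) :
    ∫ u, f u ∂(lineMeasure volume b ∗ ν) =
      (∫ u in {u | 0 ≤ ω u}, f u ∂(lineMeasure volume b ∗ ν)) +
        ∫ u in {u | 0 ≤ (-ω) u}, f u ∂(lineMeasure volume b ∗ ν) := by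
  rw [← integral_add_measure hf.restrict hf.restrict, restrict_lineMeasure_conv hb hν,
    restrict_neg_lineMeasure_conv hb hν, ← Measure.conv_add, ← lineMeasure_volume,
    Measure.conv_comm]

theorem convList_conv_dirac {l : List U} {y : U} (hy : y ∈ l) (c : ℝ) :
    convList volume l ∗ Measure.dirac (c • y) = convList volume l := by
  induction l with
  | nil => simp at hy
  | cons x l ih =>
    rcases List.mem_cons.1 hy with rfl | hy
    · rw [convList, Measure.conv_comm (lineMeasure volume y), Measure.conv_assoc,
        lineMeasure_conv_dirac]
    · rw [convList, Measure.conv_assoc, ih hy]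

theorem ae_convList_eq_zero {m : Measure ℝ} [SFinite m] {l : List U} (hl : ∀ y ∈ l, ω y = 0) :
    ∀ᵐ x ∂convList m l, ω x = 0 := by
  have : ProperSpace U := FiniteDimensional.proper_real U
  have hm : MeasurableSet {x | ω x = 0} :=
    (isClosed_eq (continuous_functional ω) continuous_const).measurableSet
  induction l with
  | nil =>
    rw [convList, ae_dirac_iff hm, map_zero]
  | cons y l ih =>
    refine ae_conv (p := fun x => ω x = 0) hm (ae_lineMeasure hm ?_)
      (ih fun y' hy' => hl y' (List.mem_cons_of_mem _ hy')) ?_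
    · simp [hl y List.mem_cons_self]
    · intro x z hx hz
      rw [map_add, hx, hz, add_zero]

theorem isFiniteMeasureOnCompacts_lineMeasure_conv {ν : Measure U} [IsFiniteMeasureOnCompacts ν]
    {b : U} (hb : ω b = 1) (hν : ∀ᵐ x ∂ν, ω x = 0) :
    IsFiniteMeasureOnCompacts (lineMeasure volume b ∗ ν) := by
  have : ProperSpace U := FiniteDimensional.proper_real U
  have hb0 : b ≠ 0 := by rintro rfl; simp at hb
  have := isFiniteMeasureOnCompacts_lineMeasure hb0
  rw [Measure.conv_comm]
  have hC : 0 < ‖b‖ := norm_pos_iff.2 hb0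
  refine isFiniteMeasureOnCompacts_conv (properPair_ker (ω := ω) hC) hν (ae_lineMeasure
    (p := fun x => x ∈ coneSet ω ‖b‖ ∪ coneSet (-ω) ‖b‖)
    (isClosed_coneSet.union isClosed_coneSet).measurableSet (Filter.Eventually.of_forall ?_))
  intro c
  simp only [coneSet, Set.mem_union, Set.mem_ofPred_eq, norm_smul, map_smul, LinearMap.neg_apply,
    hb, Real.norm_eq_abs, smul_eq_mul, mul_one]
  rcases le_total 0 c with h | h
  · left; rw [abs_of_nonneg h, mul_comm]
  · right; rw [abs_of_nonpos h, mul_comm]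

namespace ListBasis

variable {N r : ℕ} {X : Fin N → U} (B : ListBasis r X)

instance (k : Fin (r + 1)) : SFinite (B.flagMeasure k) := by
  unfold flagMeasure; infer_instance

theorem flagMeasure_succ (k : Fin r) : B.flagMeasure k.succ =
    lineMeasure volume (B.vec k) ∗ B.flagMeasure k.castSucc := by
  rw [flagMeasure, levels_succ, convList_perm _ ((Finset.toList_insert (by simp)).map _)]
  rfl

theorem ae_flagMeasure (k : Fin (r + 1)) (j : Fin r) (h : k ≤ j.castSucc) :
    ∀ᵐ x ∂B.flagMeasure k, B.coord j x = 0 := by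
  refine ae_convList_eq_zero fun y hy => ?_
  obtain ⟨i, hi, rfl⟩ := List.mem_map.1 hy
  have hi' : i.castSucc < k := by simpa using hi
  have : i ≠ j := fun hij => absurd (hij ▸ hi') (not_lt.2 h)
  rw [coord_vec, if_neg this]

instance (k : Fin (r + 1)) : IsFiniteMeasureOnCompacts (B.flagMeasure k) := by
  induction k using Fin.induction with
  | zero => rw [flagMeasure_zero]; infer_instance
  | succ k ih =>
    rw [flagMeasure_succ]
    exact isFiniteMeasureOnCompacts_lineMeasure_conv (ω := B.coord k) (by simp [coord_vec])
      (B.ae_flagMeasure _ k le_rfl)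

theorem flagMeasure_map_add (k : Fin (r + 1)) {u : U}
    (hu : ∀ j : Fin r, k ≤ j.castSucc → B.coord j u = 0) :
    (B.flagMeasure k).map (fun x => x + u) = B.flagMeasure k := by
  rw [← Measure.conv_dirac, ← B.sum_coord u]
  refine Finset.sum_induction _ (fun v => B.flagMeasure k ∗ Measure.dirac v = B.flagMeasure k)
    (fun v w hv hw => ?_) (Measure.conv_dirac_zero _) fun j _ => ?_
  · change B.flagMeasure k ∗ Measure.dirac (v + w) = _
    rw [← Measure.dirac_conv_dirac, ← Measure.conv_assoc, hv, hw]
  · rcases le_or_gt k j.castSucc with h | h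
    · rw [hu j h, zero_smul, Measure.conv_dirac_zero]
    · exact convList_conv_dirac (List.mem_map.2 ⟨j, by simpa using h, rfl⟩) _

theorem flagMeasure_last : B.flagMeasure (Fin.last r) = B.basis.addHaar := by
  have h1 : B.flagMeasure (Fin.last r) = pushPi volume B.vec := by
    rw [flagMeasure, levels_last, ← pushPi_finset,
      ← pushPi_equiv volume (Equiv.subtypeUnivEquiv
        (p := fun e : Fin r => e ∈ (Finset.univ : Finset (Fin r))) fun _ => Finset.mem_univ _) B.vec]
    rfl
  let f : (Fin r → ℝ) ≃L[ℝ] U := B.basis.equivFun.symm.toContinuousLinearEquiv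
  have h2 : (fun c : Fin r → ℝ => ∑ i, c i • B.vec i) = f := by
    ext c
    simp [f, Module.Basis.equivFun_symm_apply]
  have h3 : (volume : Measure (Fin r → ℝ)) = (Pi.basisFun ℝ (Fin r)).addHaar := by
    rw [← addHaarMeasure_eq_volume_pi, ← Module.Basis.parallelepiped_basisFun,
      ← Module.Basis.addHaar_def]
  rw [h1, pushPi, ← volume_pi, h2, h3, Module.Basis.map_addHaar]
  congr 1
  ext i
  simp [f]

/-- The source of the factor `|det B|`: the parallelepiped of `B` has this volume for the measure
normalized by `s`. -/
theorem addHaar_eq_smul (s : Module.Basis (Fin r) ℝ U) :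
    s.addHaar = ENNReal.ofReal |s.det B.vec| • B.basis.addHaar := by
  have : ProperSpace U := FiniteDimensional.proper_real U
  have h1 : s.addHaar = s.addHaar (parallelepiped B.basis) • B.basis.addHaar := by
    rw [Module.Basis.addHaar_def B.basis]
    exact Measure.addHaarMeasure_unique s.addHaar B.basis.parallelepiped
  rw [h1, B.coe_basis, Measure.addHaar_parallelepiped]

end ListBasis

end FlagMeasures
-- Orientation and signs of a level
section Halves

variable {U : Type*} [NormedAddCommGroup U] [NormedSpace ℝ U] {N r : ℕ} {X : Fin N → U}

/-- Only the quotient `η / η(y)` enters, which is why both half-spaces carry the same polynomial. -/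
theorem primitive_neg (s : Module.Basis (Fin r) ℝ U) (η : U →ₗ[ℝ] ℝ) (y : U)
    (g : MvPolynomial (Fin r) ℝ) : primitive s (-η) y g = primitive s η y g := by
  have h : dualForm s (-η) = -dualForm s η := by simp [dualForm]
  have h2 : ((-η) y)⁻¹ • dualForm s (-η) = (η y)⁻¹ • dualForm s η := by
    rw [h, LinearMap.neg_apply, inv_neg, neg_smul, smul_neg, neg_neg]
  rw [primitive, primitive, h2]

theorem primitives_neg (s : Module.Basis (Fin r) ℝ U) (η : U →ₗ[ℝ] ℝ) (l : List (Fin N))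
    (g : MvPolynomial (Fin r) ℝ) : primitives s (-η) X l g = primitives s η X l g := by
  unfold primitives
  simp_rw [primitive_neg]

namespace ListBasis

variable (B : ListBasis r X)

theorem det_vec_ne_zero (s : Module.Basis (Fin r) ℝ U) : s.det B.vec ≠ 0 := by
  rw [← B.coe_basis]
  exact (s.isUnit_det B.basis).ne_zero

/-- The required values on `b_1, …, b_{i+1}` force the endomorphism to be the transvection `v ↦ v +
coord_i(v) (u - b_i)` (indexing by `i`), whose determinant `1 + coord_i(u - b_i)` equals
`coord_i(u)`. -/
theorem isPositive_iff {i : Fin r} {u : U} (hu : u ∈ B.flag (i + 1)) :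
    B.IsPositive i u ↔ 0 < B.coord i u := by
  have hmem : ∀ j : Fin r, j ≤ i → B.vec j ∈ B.flag (i + 1) := fun j hj =>
    Submodule.subset_span ⟨j, Nat.lt_succ_of_le hj, rfl⟩
  have : FiniteDimensional ℝ U := B.basis.finiteDimensional_of_finite
  let f : B.flag (i + 1) →ₗ[ℝ] ℝ := (B.coord i).domRestrict _
  let w : B.flag (i + 1) := ⟨u, hu⟩ - ⟨B.vec i, hmem i le_rfl⟩
  have hf : ∀ v, f v = B.coord i v := fun _ => rfl
  have hfix : ∀ v : B.flag (i + 1),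
      (∀ j < i, (v : U) = B.vec j → LinearMap.transvection f w v = v) ∧
        ((v : U) = B.vec i → (LinearMap.transvection f w v : U) = u) := by
    refine fun v => ⟨fun j hj hv => ?_, fun hv => ?_⟩
    · simp [LinearMap.transvection.apply, hf, hv, coord_vec, hj.ne]
    · simp [LinearMap.transvection.apply, hf, hv, coord_vec, w]
  have hdet : LinearMap.det (LinearMap.transvection f w) = B.coord i u := by
    rw [LinearMap.transvection.det, hf]
    simp [w, coord_vec]
  refine ⟨?_, fun h => ⟨_, hfix, hdet ▸ h⟩⟩
  rintro ⟨g, hg, hpos⟩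
  have : g = LinearMap.transvection f w := by
    have h1 : ∀ (v : U) (hv : v ∈ B.flag (i + 1)), g ⟨v, hv⟩ = LinearMap.transvection f w ⟨v, hv⟩ := by
      intro v hv
      refine Submodule.span_induction (p := fun v hv =>
        g ⟨v, hv⟩ = LinearMap.transvection f w ⟨v, hv⟩) ?_ ?_ ?_ ?_ hv
      · rintro v ⟨j, hj, rfl⟩
        rcases (Nat.lt_succ_iff.1 hj).lt_or_eq with h | h
        · rw [(hg _).1 j h rfl, (hfix _).1 j h rfl]
        · obtain rfl : j = i := Fin.ext h
          exact Subtype.ext (((hg _).2 rfl).trans ((hfix _).2 rfl).symm)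
      · exact (map_zero g).trans (map_zero (LinearMap.transvection f w)).symm
      · intro x y hx hy h1 h2
        have h3 := map_add g ⟨x, hx⟩ ⟨y, hy⟩
        rw [h1, h2, ← map_add] at h3
        exact h3
      · intro c x hx h1
        have h3 := map_smul g c ⟨x, hx⟩
        rw [h1, ← map_smul] at h3
        exact h3
    ext v
    rw [h1 v v.2]
  rw [← hdet, ← this]
  exact hpos

theorem mem_level_iff {k : Fin r} {e : Fin N} : e ∈ B.level k ↔
    e ∈ B.extActiveᶜ ∧ X e ∈ B.flag (k + 1) ∧ X e ∉ B.flag k := by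
  rw [mem_level, Finset.mem_compl, mem_flag_iff, mem_flag_iff]
  refine and_congr_right fun _ => ⟨fun h => ⟨fun j hj => h.1 j hj, fun h' => h.2 (h' k le_rfl)⟩,
    fun h => ⟨fun j hj => h.1 j hj, fun h0 => h.2 fun j hj => ?_⟩⟩
  rcases hj.lt_or_eq with h' | h'
  · exact h.1 j h'
  · obtain rfl : k = j := Fin.ext h'
    exact h0

theorem mem_pos_iff {k : Fin r} {e : Fin N} : e ∈ B.pos B.extActiveᶜ k ↔
    e ∈ B.level k ∧ 0 < B.coord k (X e) := by
  classical
  rw [mem_level_iff, pos, Finset.mem_filter]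
  constructor
  · rintro ⟨h1, h2, h3, h4⟩
    exact ⟨⟨h1, h2, h3⟩, (B.isPositive_iff h2).1 h4⟩
  · rintro ⟨⟨h1, h2, h3⟩, h4⟩
    exact ⟨h1, h2, h3, (B.isPositive_iff h2).2 h4⟩

theorem mem_neg_iff {k : Fin r} {e : Fin N} : e ∈ B.neg B.extActiveᶜ k ↔
    e ∈ B.level k ∧ ¬ 0 < B.coord k (X e) := by
  classical
  rw [mem_level_iff, neg, Finset.mem_filter]
  constructor
  · rintro ⟨h1, h2, h3, h4⟩
    exact ⟨⟨h1, h2, h3⟩, fun h => h4 ((B.isPositive_iff h2).2 h)⟩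
  · rintro ⟨⟨h1, h2, h3⟩, h4⟩
    exact ⟨h1, h2, h3, fun h => h4 ((B.isPositive_iff h2).1 h)⟩

theorem disjoint_pos_neg (k : Fin r) :
    Disjoint (B.pos B.extActiveᶜ k) (B.neg B.extActiveᶜ k) :=
  Finset.disjoint_left.2 fun _ h1 h2 => (B.mem_neg_iff.1 h2).2 (B.mem_pos_iff.1 h1).2

theorem pos_disjUnion_neg (k : Fin r) :
    (B.pos B.extActiveᶜ k).disjUnion (B.neg B.extActiveᶜ k) (B.disjoint_pos_neg k) = B.level k := by
  ext e
  rw [Finset.mem_disjUnion, mem_pos_iff, mem_neg_iff]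
  tauto

/-- The vectors of `Z ∩ (S_{k+1} ∖ S_k)`, with the signs that make `ω` positive. -/
noncomputable def rays (ω : U →ₗ[ℝ] ℝ) (k : Fin r) : List U :=
  (B.level k).toList.map fun e => signOf ω (X e) • X e

/-- Separates the ray of the basis vector, which spreads the density into the half-space, from the
rays that take primitives. -/
theorem rays_perm (ω : U →ₗ[ℝ] ℝ) (k : Fin r) :
    (((B.levelRest k).toList.map fun e => signOf ω (X e) • X e) ++
      [signOf ω (B.vec k) • B.vec k]).Perm (B.rays ω k) := by
  classical
  have h : B.level k = insert (B.idx k) (B.levelRest k) :=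
    (Finset.insert_erase (B.idx_mem_level k)).symm
  rw [rays, h]
  refine (List.perm_append_comm).trans ?_
  exact ((Finset.toList_insert (Finset.notMem_erase (B.idx k) (B.level k))).map
    fun e => signOf ω (X e) • X e).symm

theorem signOf_vec (k : Fin r) : signOf (B.coord k) (B.vec k) = 1 := by
  simp [signOf, coord_vec]

theorem signOf_neg_vec (k : Fin r) : signOf (-B.coord k) (B.vec k) = -1 := by
  simp [signOf, coord_vec]

theorem prod_signOf (ω : U →ₗ[ℝ] ℝ) (k : Fin r) : signOf ω (B.vec k) *
    ((B.levelRest k).toList.map fun e => signOf ω (X e)).prod =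
      (∏ e ∈ B.pos B.extActiveᶜ k, signOf ω (X e)) *
        ∏ e ∈ B.neg B.extActiveᶜ k, signOf ω (X e) := by
  classical
  rw [← Finset.prod_disjUnion (B.disjoint_pos_neg k), pos_disjUnion_neg,
    ← Finset.mul_prod_erase _ _ (B.idx_mem_level k), Finset.prod_map_toList]
  rfl

theorem signOf_of_mem_pos {k : Fin r} {e : Fin N} (h : e ∈ B.pos B.extActiveᶜ k) :
    signOf (B.coord k) (X e) = 1 :=
  if_pos (B.mem_pos_iff.1 h).2

theorem signOf_of_mem_neg {k : Fin r} {e : Fin N} (h : e ∈ B.neg B.extActiveᶜ k) :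
    signOf (B.coord k) (X e) = -1 :=
  if_neg (B.mem_neg_iff.1 h).2

theorem signOf_neg_of_mem_pos {k : Fin r} {e : Fin N} (h : e ∈ B.pos B.extActiveᶜ k) :
    signOf (-B.coord k) (X e) = -1 :=
  if_neg (by simpa using (B.mem_pos_iff.1 h).2.le)

theorem signOf_neg_of_mem_neg {k : Fin r} {e : Fin N} (h : e ∈ B.neg B.extActiveᶜ k) :
    signOf (-B.coord k) (X e) = 1 := by
  obtain ⟨h1, h2⟩ := B.mem_neg_iff.1 h
  have h3 := (mem_level.1 h1).2.2
  exact if_pos (by simpa using lt_of_le_of_ne (not_lt.1 h2) h3)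

theorem prod_signOf_coord (k : Fin r) :
    ((B.levelRest k).toList.map fun e => signOf (B.coord k) (X e)).prod =
      (-1) ^ (B.neg B.extActiveᶜ k).card := by
  have h := B.prod_signOf (B.coord k) k
  rwa [signOf_vec, one_mul, Finset.prod_congr rfl fun e he => B.signOf_of_mem_pos he,
    Finset.prod_congr rfl fun e he => B.signOf_of_mem_neg he, Finset.prod_const_one, one_mul,
    Finset.prod_const] at h

/-- The extra minus sign arises because `b_k` is counted in `P_k` but absent from `levelRest`. It
cancels the minus sign between the two terms of `R_k`. -/
theorem prod_signOf_neg_coord (k : Fin r) :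
    ((B.levelRest k).toList.map fun e => signOf (-B.coord k) (X e)).prod =
      -(-1) ^ (B.pos B.extActiveᶜ k).card := by
  have h := B.prod_signOf (-B.coord k) k
  rw [signOf_neg_vec, Finset.prod_congr rfl fun e he => B.signOf_neg_of_mem_pos he,
    Finset.prod_congr rfl fun e he => B.signOf_neg_of_mem_neg he, Finset.prod_const_one, mul_one,
    Finset.prod_const] at h
  linarith

theorem splines_perm {y y' : Fin N → U} {ω : U →ₗ[ℝ] ℝ} {k : Fin r}
    (h : ∀ e ∈ B.pos B.extActiveᶜ k, signOf ω (X e) • X e = y e)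
    (h' : ∀ e ∈ B.neg B.extActiveᶜ k, signOf ω (X e) • X e = y' e) :
    ((B.pos B.extActiveᶜ k).toList.map y ++ (B.neg B.extActiveᶜ k).toList.map y').Perm
      (B.rays ω k) := by
  have h1 : ((B.pos B.extActiveᶜ k).toList ++ (B.neg B.extActiveᶜ k).toList).Perm
      (B.level k).toList := by
    rw [← pos_disjUnion_neg]
    refine (List.perm_ext_iff_of_nodup ?_ (Finset.nodup_toList _)).2 fun e => by simp
    exact List.Nodup.append (Finset.nodup_toList _) (Finset.nodup_toList _) fun e h1 h2 =>
      Finset.disjoint_left.1 (B.disjoint_pos_neg k) (Finset.mem_toList.1 h1) (Finset.mem_toList.1 h2)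
  refine List.Perm.trans (List.Perm.of_eq ?_) (h1.map _)
  rw [List.map_append]
  congr 1
  · exact List.map_congr_left fun e he => (h e (Finset.mem_toList.1 he)).symm
  · exact List.map_congr_left fun e he => (h' e (Finset.mem_toList.1 he)).symm

end ListBasis

end Halves
-- The splines of one level
section Convolutions

open MeasureTheory

variable {U : Type*} [NormedAddCommGroup U] [NormedSpace ℝ U] {ω : U →ₗ[ℝ] ℝ} {C : ℝ}

theorem signOf_smul_mem_coneSet {v : U} (h : ‖v‖ ≤ C * |ω v|) :
    signOf ω v • v ∈ coneSet ω C := by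
  change ‖signOf ω v • v‖ ≤ C * ω (signOf ω v • v)
  refine le_of_eq_of_le ?_ (h.trans_eq ?_)
  · unfold signOf; split_ifs <;> simp
  · unfold signOf
    split_ifs with h'
    · rw [abs_of_pos h', one_smul]
    · rw [abs_of_nonpos (not_lt.1 h'), neg_one_smul, map_neg]

namespace ListBasis

variable {N r : ℕ} {X : Fin N → U} (B : ListBasis r X) {k : Fin r}

/-- The bound involves only the absolute value of the coordinate, so one constant gives cones on
both sides. -/
theorem exists_norm_le (k : Fin r) :
    ∃ C, 0 < C ∧ ∀ e ∈ B.level k, ‖X e‖ ≤ C * |B.coord k (X e)| := by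
  classical
  obtain ⟨C, hC, h⟩ := exists_mem_coneSet (ω := B.coord k)
    ((B.level k).image fun e => signOf (B.coord k) (X e) • X e) (by
      simp only [Finset.mem_image, forall_exists_index, and_imp, forall_apply_eq_imp_iff₂]
      exact fun e he => pos_signOf_smul (mem_level.1 he).2.2)
  refine ⟨C, hC, fun e he => ?_⟩
  have h1 := h _ (Finset.mem_image_of_mem _ he)
  change ‖_‖ ≤ C * B.coord k _ at h1
  unfold signOf at h1
  split_ifs at h1 with h'
  · rw [abs_of_pos h']
    simpa using h1
  · rw [abs_of_nonpos (not_lt.1 h')]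
    simpa using h1

theorem signOf_smul_mem (hω : ω = B.coord k ∨ ω = -B.coord k)
    (hl : ∀ e ∈ B.level k, ‖X e‖ ≤ C * |B.coord k (X e)|)
    {e : Fin N} (he : e ∈ B.level k) :
    signOf ω (X e) • X e ∈ coneSet ω C ∧ signOf ω (X e) • X e ≠ 0 := by
  have h1 := hl e he
  have h2 := (mem_level.1 he).2.2
  have h3 : ω (X e) ≠ 0 ∧ |ω (X e)| = |B.coord k (X e)| := by
    rcases hω with rfl | rfl <;> simp [h2]
  refine ⟨signOf_smul_mem_coneSet (h3.2 ▸ h1), fun h => ?_⟩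
  have h4 := pos_signOf_smul h3.1
  rw [h, map_zero] at h4
  exact lt_irrefl _ h4

end ListBasis

variable [FiniteDimensional ℝ U] [MeasurableSpace U] [BorelSpace U]

theorem ConeMeasure.measDistr_eq_zero {μ : Measure U} (hμ : ConeMeasure ω C μ) (φ : Test U)
    (h : ∀ u ∈ coneSet ω C, φ u = 0) : measDistr μ (fun _ => 1) φ = 0 := by
  have := hμ.finite
  rw [measDistr_one_apply, integral_eq_zero_of_ae]
  filter_upwards [hμ.ae_mem] with u hu
  exact h u hu

theorem isSplineConv_convList {E : Type*} (hC : 0 < C) {P P' : Finset E} {y y' : E → U}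
    (hy : ∀ e ∈ P, y e ∈ coneSet ω C ∧ y e ≠ 0) (hy' : ∀ e ∈ P', y' e ∈ coneSet ω C ∧ y' e ≠ 0)
    {l : List U} (hl : (P.toList.map y ++ P'.toList.map y').Perm l) :
    IsSplineConv (fun e : P => y e) (fun e : P' => y' e)
      (measDistr (convList halfLine l) fun _ => 1) := by
  have hp : ConeMeasure ω C (pushPi halfLine fun e : P => y e) := by
    rw [pushPi_finset]
    exact ConeMeasure.convList hC fun v hv => by
      obtain ⟨e, he, rfl⟩ := List.mem_map.1 hv
      exact hy e (Finset.mem_toList.1 he)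
  have hp' : ConeMeasure ω C (pushPi halfLine fun e : P' => y' e) := by
    rw [pushPi_finset]
    exact ConeMeasure.convList hC fun v hv => by
      obtain ⟨e, he, rfl⟩ := List.mem_map.1 hv
      exact hy' e (Finset.mem_toList.1 he)
  have := hp.finite
  have := hp'.finite
  have hconv : convList halfLine l =
      (pushPi halfLine fun e : P => y e) ∗ pushPi halfLine fun e : P' => y' e := by
    rw [← convList_perm _ hl, convList_append, pushPi_finset, pushPi_finset]
  have := (hp.conv hC hp').finite
  refine ⟨_, _, measDistr_isSpline _, measDistr_isSpline _, ?_⟩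
  rw [hconv]
  refine isConvolution_measDistr (properPair_coneSet hC) isClosed_coneSet isClosed_coneSet
    continuous_const hp.ae_mem hp'.measDistr_eq_zero (fun φ => ?_) fun φ => ?_
  · simp_rw [measDistr_one_apply, translate_apply]
    exact contDiff_integral_translate _ φ.contDiff φ.hasCompactSupport
  · simp_rw [measDistr_one_apply, translate_apply, mul_one]
    exact integral_conv (φ.continuous.integrable_of_hasCompactSupport φ.hasCompactSupport)

namespace ListBasis

variable {N r : ℕ} {X : Fin N → U} (B : ListBasis r X) {k : Fin r}

theorem coneMeasure_rays (hω : ω = B.coord k ∨ ω = -B.coord k)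
    (hl : ∀ e ∈ B.level k, ‖X e‖ ≤ C * |B.coord k (X e)|)
    (hC : 0 < C) : ConeMeasure ω C (convList halfLine (B.rays ω k)) :=
  ConeMeasure.convList hC fun v hv => by
    obtain ⟨e, he, rfl⟩ := List.mem_map.1 hv
    exact B.signOf_smul_mem hω hl (Finset.mem_toList.1 he)

theorem integral_rays (hω : ω = B.coord k ∨ ω = -B.coord k)
    (hl : ∀ e ∈ B.level k, ‖X e‖ ≤ C * |B.coord k (X e)|)
    (s : Module.Basis (Fin r) ℝ U) (hC : 0 < C) (φ : Test U) :
    ∫ ξ, polyFun s (B.partialPoly s k.castSucc) ξ *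
        (∫ z, φ (ξ + z) ∂convList halfLine (B.rays ω k)) ∂B.flagMeasure k.castSucc =
      ((B.levelRest k).toList.map fun e => signOf ω (X e)).prod *
        ∫ u in {u | 0 ≤ ω u}, polyFun s (B.partialPoly s k.succ) u * φ u
          ∂B.flagMeasure k.succ := by
  have hν := B.ae_flagMeasure k.castSucc k le_rfl
  have hb : ω (signOf ω (B.vec k) • B.vec k) = 1 := by
    rcases hω with rfl | rfl
    · simp [signOf_vec, coord_vec]
    · simp [signOf_neg_vec, coord_vec]
  have hκ : (B.flagMeasure k.succ).restrict {u | 0 ≤ ω u} =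
      B.flagMeasure k.castSucc ∗ lineMeasure halfLine (signOf ω (B.vec k) • B.vec k) := by
    rw [flagMeasure_succ]
    rcases hω with rfl | rfl
    · rw [signOf_vec, one_smul]
      exact restrict_lineMeasure_conv (by simp [coord_vec]) hν
    · rw [signOf_neg_vec, neg_one_smul]
      exact restrict_neg_lineMeasure_conv (by simp [coord_vec]) hν
  have hp : primitives s ω X (B.levelRest k).toList (B.partialPoly s k.castSucc) =
      B.partialPoly s k.succ := by
    rw [partialPoly_succ]
    rcases hω with rfl | rfl
    · rfl
    · rw [primitives_neg]
  have hlev : ∀ e ∈ (B.levelRest k).toList, e ∈ B.level k := fun e he =>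
    Finset.mem_of_mem_erase (Finset.mem_toList.1 he)
  rw [← convList_perm _ (B.rays_perm ω k), ← hp]
  refine integral_convList hC hb (B.signOf_smul_mem hω hl (B.idx_mem_level k)).1 ?_ hκ
    (B.isHomogeneous_partialPoly _) ?_ (fun e he => ?_)
    (fun e he => (B.signOf_smul_mem hω hl (hlev e he)).1) (fun e he c => ?_) φ
  · filter_upwards [hν] with x hx
    rcases hω with rfl | rfl <;> simp [hx]
  · rw [dirDeriv_smul_left, dirDeriv_partialPoly _ _ _ le_rfl, smul_zero]
  · have := (mem_level.1 (hlev e he)).2.2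
    rcases hω with rfl | rfl <;> simpa using this
  · refine B.flagMeasure_map_add _ fun j hj => ?_
    rw [map_smul, (mem_level.1 (hlev e he)).2.1 j (Fin.succ_le_castSucc_iff.1 hj), smul_zero]

end ListBasis

end Convolutions
-- The distributions `R^B` and their polynomial densities
section BasisDistributions

open MeasureTheory

variable {U : Type*} [NormedAddCommGroup U] [NormedSpace ℝ U] [FiniteDimensional ℝ U]
  {N r : ℕ} {X : Fin N → U} (B : ListBasis r X)

namespace ListBasis

variable [MeasurableSpace U] [BorelSpace U]

/-- The distribution `R^B_{k+1}`. -/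
noncomputable def factor (k : Fin r) : Distr U :=
  (-1 : ℝ) ^ (B.neg B.extActiveᶜ k).card •
      measDistr (convList halfLine (B.rays (B.coord k) k)) (fun _ => 1) -
    (-1 : ℝ) ^ (B.pos B.extActiveᶜ k).card •
      measDistr (convList halfLine (B.rays (-B.coord k) k)) (fun _ => 1)

theorem isFactor_factor (k : Fin r) : IsFactor X B.extActiveᶜ B k (B.factor k) := by
  obtain ⟨C, hC, hl⟩ := B.exists_norm_le k
  have hP : ∀ e ∈ B.pos B.extActiveᶜ k, e ∈ B.level k := fun e he => (B.mem_pos_iff.1 he).1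
  have hN : ∀ e ∈ B.neg B.extActiveᶜ k, e ∈ B.level k := fun e he => (B.mem_neg_iff.1 he).1
  have h1 : ∀ e ∈ B.pos B.extActiveᶜ k, signOf (B.coord k) (X e) • X e = X e := fun e he => by
    rw [B.signOf_of_mem_pos he, one_smul]
  have h2 : ∀ e ∈ B.neg B.extActiveᶜ k, signOf (B.coord k) (X e) • X e = -X e := fun e he => by
    rw [B.signOf_of_mem_neg he, neg_one_smul]
  have h3 : ∀ e ∈ B.pos B.extActiveᶜ k, signOf (-B.coord k) (X e) • X e = -X e := fun e he => by
    rw [B.signOf_neg_of_mem_pos he, neg_one_smul]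
  have h4 : ∀ e ∈ B.neg B.extActiveᶜ k, signOf (-B.coord k) (X e) • X e = X e := fun e he => by
    rw [B.signOf_neg_of_mem_neg he, one_smul]
  refine ⟨_, _, ?_, ?_, rfl⟩
  · exact isSplineConv_convList hC (y := X) (y' := fun e => -X e)
      (fun e he => h1 e he ▸ B.signOf_smul_mem (.inl rfl) hl (hP e he))
      (fun e he => h2 e he ▸ B.signOf_smul_mem (.inl rfl) hl (hN e he)) (B.splines_perm h1 h2)
  · exact isSplineConv_convList hC (y := fun e => -X e) (y' := X)
      (fun e he => h3 e he ▸ B.signOf_smul_mem (.inr rfl) hl (hP e he))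
      (fun e he => h4 e he ▸ B.signOf_smul_mem (.inr rfl) hl (hN e he)) (B.splines_perm h3 h4)

/-- The distribution `R^B_1 * ⋯ * R^B_k`. -/
noncomputable def partialDistr (s : Module.Basis (Fin r) ℝ U) (k : Fin (r + 1)) : Distr U :=
  measDistr (B.flagMeasure k) (polyFun s (B.partialPoly s k))

/-- By `integral_rays` each half of `R_k` yields the next density on its own half-space, up to a
sign. That sign meets its own coefficient and squares to `1`, and the two half-space integrals add
up to the integral over the next flag measure. -/
theorem isConvolution_partialDistr (s : Module.Basis (Fin r) ℝ U) (k : Fin r) :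
    IsConvolution (B.partialDistr s k.castSucc) (B.factor k) (B.partialDistr s k.succ) := by
  obtain ⟨C, hC, hl⟩ := B.exists_norm_le k
  have hp := B.coneMeasure_rays (.inl rfl) hl hC
  have hn := B.coneMeasure_rays (.inr rfl) hl hC
  have := hp.finite
  have := hn.finite
  have hν := B.ae_flagMeasure k.castSucc k le_rfl
  have happ : ∀ φ : Test U, B.factor k φ =
      (-1 : ℝ) ^ (B.neg B.extActiveᶜ k).card *
          (∫ z, φ z ∂convList halfLine (B.rays (B.coord k) k)) -
        (-1 : ℝ) ^ (B.pos B.extActiveᶜ k).card *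
          ∫ z, φ z ∂convList halfLine (B.rays (-B.coord k) k) := fun φ => by
    rw [← measDistr_one_apply, ← measDistr_one_apply]
    rfl
  have hint : ∀ {ω : U →ₗ[ℝ] ℝ}, (ω = B.coord k ∨ ω = -B.coord k) → ∀ φ : Test U, Integrable
      (fun ξ => polyFun s (B.partialPoly s k.castSucc) ξ *
        ∫ z, φ (ξ + z) ∂convList halfLine (B.rays ω k)) (B.flagMeasure k.castSucc) := by
    intro ω hω φ
    have hm := B.coneMeasure_rays hω hl hC
    have := hm.finite
    have hν' : ∀ᵐ x ∂B.flagMeasure k.castSucc, x ∈ {x | ω x = 0} := by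
      filter_upwards [hν] with x hx
      rcases hω with rfl | rfl <;> simp [hx]
    have h := (integrable_prod_translate (properPair_ker hC) hν'
      (hm.ae_mem.mono fun x hx => Or.inl hx) (continuous_polyFun s (B.partialPoly s k.castSucc))
      φ.continuous φ.hasCompactSupport).integral_prod_left
    simpa only [integral_const_mul] using h
  refine isConvolution_measDistr (properPair_ker (ω := B.coord k) hC)
    (isClosed_eq (continuous_functional _) continuous_const)
    (isClosed_coneSet.union isClosed_coneSet) (continuous_polyFun s _) hν (fun φ hφ => ?_)
    (fun φ => ?_) fun φ => ?_
  · rw [happ, ← measDistr_one_apply, ← measDistr_one_apply,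
      hp.measDistr_eq_zero φ fun u hu => hφ u (.inl hu),
      hn.measDistr_eq_zero φ fun u hu => hφ u (.inr hu), mul_zero, mul_zero, sub_zero]
  · simp_rw [happ, translate_apply]
    exact (contDiff_const.mul (contDiff_integral_translate _ φ.contDiff φ.hasCompactSupport)).sub
      (contDiff_const.mul (contDiff_integral_translate _ φ.contDiff φ.hasCompactSupport))
  · have hsq : ∀ n : ℕ, (-1 : ℝ) ^ n * (-1) ^ n = 1 := fun n => by
      rw [← mul_pow]; norm_num
    have hi : Integrable (fun u => polyFun s (B.partialPoly s k.succ) u * φ u)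
        (B.flagMeasure k.succ) :=
      ((continuous_polyFun s _).mul φ.continuous).integrable_of_hasCompactSupport
        φ.hasCompactSupport.mul_left
    have hsplit := hi
    rw [flagMeasure_succ] at hsplit
    have h0 := integral_lineMeasure_conv (ω := B.coord k) (by simp [coord_vec]) hν hsplit
    rw [← flagMeasure_succ] at h0
    have h1 := B.integral_rays (.inl rfl) hl s hC φ
    have h2 := B.integral_rays (.inr rfl) hl s hC φ
    rw [prod_signOf_coord] at h1
    rw [prod_signOf_neg_coord] at h2
    rw [partialDistr, measDistr_apply _ (continuous_polyFun s _)]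
    simp_rw [happ, translate_apply, mul_comm (φ _), h0, sub_mul, mul_assoc]
    simp_rw [mul_comm (∫ _, _ ∂_) (polyFun s _ _)]
    rw [integral_sub ((hint (.inl rfl) φ).const_mul _) ((hint (.inr rfl) φ).const_mul _),
      integral_const_mul, integral_const_mul, h1, h2, ← mul_assoc, hsq, one_mul, neg_mul,
      mul_neg, ← mul_assoc, hsq, one_mul, sub_neg_eq_add]

theorem partialDistr_zero (s : Module.Basis (Fin r) ℝ U) :
    B.partialDistr s 0 = Distribution.delta 0 := by
  ext φ
  have : ProperSpace U := FiniteDimensional.proper_real U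
  rw [partialDistr, measDistr_apply _ (continuous_polyFun s _), flagMeasure_zero,
    partialPoly_zero]
  simp [polyFun_one]

theorem isBasisDistr_partialDistr (s : Module.Basis (Fin r) ℝ U) :
    IsBasisDistr X B.extActiveᶜ B (B.partialDistr s (Fin.last r)) :=
  ⟨B.partialDistr s, B.partialDistr_zero s,
    fun k => ⟨_, B.isFactor_factor k, B.isConvolution_partialDistr s k⟩, rfl⟩

theorem partialDistr_last (s : Module.Basis (Fin r) ℝ U) :
    B.partialDistr s (Fin.last r) = polyDistr s (|s.det B.vec|⁻¹ • B.dualPoly s) := by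
  ext φ
  have : ProperSpace U := FiniteDimensional.proper_real U
  have h : |s.det B.vec| ≠ 0 := abs_ne_zero.2 (B.det_vec_ne_zero s)
  rw [partialDistr, measDistr_apply _ (continuous_polyFun s _), polyDistr_apply,
    B.addHaar_eq_smul s, integral_smul_measure, flagMeasure_last,
    ENNReal.toReal_ofReal (abs_nonneg _)]
  simp_rw [polyFun_smul, mul_left_comm (φ _)]
  rw [integral_const_mul, smul_eq_mul, ← mul_assoc, mul_inv_cancel₀ h, one_mul]
  rfl

end ListBasis

theorem IsSplineConv.unique {ι κ : Type*} [Fintype ι] [Fintype κ] {Y : ι → U} {Y' : κ → U}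
    {T T' : Distr U} (h : IsSplineConv Y Y' T) (h' : IsSplineConv Y Y' T') : T = T' := by
  obtain ⟨A, A', hA, hA', hT⟩ := h
  obtain ⟨D, D', hD, hD', hT'⟩ := h'
  obtain rfl := hA.unique hD
  obtain rfl := hA'.unique hD'
  exact hT.unique hT'

variable {B}

theorem IsFactor.unique {Z : Finset (Fin N)} {i : Fin r} {T T' : Distr U}
    (h : IsFactor X Z B i T) (h' : IsFactor X Z B i T') : T = T' := by
  obtain ⟨A, A', hA, hA', rfl⟩ := h
  obtain ⟨D, D', hD, hD', rfl⟩ := h'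
  rw [hA.unique hD, hA'.unique hD']

/-- Splines and convolutions enter as relations; their uniqueness, applied stage by stage, makes
`R^B` a well-determined distribution. -/
theorem IsBasisDistr.unique {Z : Finset (Fin N)} {R R' : Distr U} (h : IsBasisDistr X Z B R)
    (h' : IsBasisDistr X Z B R') : R = R' := by
  obtain ⟨C, h0, hC, rfl⟩ := h
  obtain ⟨C', h0', hC', rfl⟩ := h'
  have : ∀ k, C k = C' k := fun k => by
    induction k using Fin.induction with
    | zero => rw [h0, h0']
    | succ k ih =>
      obtain ⟨F, hF, hc⟩ := hC k
      obtain ⟨F', hF', hc'⟩ := hC' k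
      obtain rfl := hF.unique hF'
      rw [ih] at hc
      exact hc.unique hc'
  exact this _

theorem polyDistr_injective [MeasurableSpace U] [BorelSpace U] (s : Module.Basis (Fin r) ℝ U) :
    Function.Injective (polyDistr s) := by
  intro f g h
  have hc := continuous_polyFun s
  have hae := ae_eq_of_integral_contDiff_smul_eq (μ := s.addHaar) (hc f).locallyIntegrable
    (hc g).locallyIntegrable fun φ hφ hφc => by
      have h1 := congrArg (fun T : Distr U => T (mkTest φ hφ hφc)) h
      simp only [polyDistr_apply, mkTest_apply] at h1
      exact h1
  exact polyFun_injective s (congrFun ((hc f).ae_eq_iff_eq s.addHaar (hc g) |>.1 hae))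

/-- The polynomial density of `R^B_{X ∖ E(B)}`. -/
theorem isBasisDistr_polyDistr_iff [MeasurableSpace U] [BorelSpace U]
    (s : Module.Basis (Fin r) ℝ U) (f : MvPolynomial (Fin r) ℝ) :
    IsBasisDistr X B.extActiveᶜ B (polyDistr s f) ↔ f = |s.det B.vec|⁻¹ • B.dualPoly s := by
  have h := B.isBasisDistr_partialDistr s
  rw [B.partialDistr_last] at h
  exact ⟨fun hf => polyDistr_injective s (hf.unique h), fun hf => hf ▸ h⟩

end BasisDistributions

end ZonotopalAlgebra

/-! ### The theorem -/

open Classical in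
theorem theorem4p2 {U : Type*} [NormedAddCommGroup U] [NormedSpace ℝ U] [MeasurableSpace U]
    [BorelSpace U] {r N : ℕ} (s : Module.Basis (Fin r) ℝ U) (X : Fin N → U)
    (hX : Submodule.span ℝ (Set.range X) = ⊤) :
    (∀ B : ZonotopalAlgebra.ListBasis r X, ∃! f : MvPolynomial (Fin r) ℝ,
      ZonotopalAlgebra.IsBasisDistr X B.extActiveᶜ B (ZonotopalAlgebra.polyDistr s f)) ∧
    ∀ R : ZonotopalAlgebra.ListBasis r X → MvPolynomial (Fin r) ℝ,
      (∀ B, ZonotopalAlgebra.IsBasisDistr X B.extActiveᶜ B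
        (ZonotopalAlgebra.polyDistr s (R B))) →
      (LinearIndependent ℝ (fun B => |s.det B.vec| • R B) ∧
        Submodule.span ℝ (Set.range fun B => |s.det B.vec| • R B) =
          ZonotopalAlgebra.spaceD s X) ∧
      (LinearIndependent ℝ (ZonotopalAlgebra.polyQ s X) ∧
        Submodule.span ℝ (Set.range (ZonotopalAlgebra.polyQ s X)) =
          ZonotopalAlgebra.spaceP s X) ∧
      ∀ B D, ZonotopalAlgebra.pairing (ZonotopalAlgebra.polyQ s X B) (|s.det D.vec| • R D) =
        if B = D then 1 else 0 := by
  have : FiniteDimensional ℝ U := s.finiteDimensional_of_finite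
  refine ⟨fun B => ⟨_, (ZonotopalAlgebra.isBasisDistr_polyDistr_iff s _).2 rfl,
    fun f hf => (ZonotopalAlgebra.isBasisDistr_polyDistr_iff s f).1 hf⟩, fun R hR => ?_⟩
  -- The factor `|det B|` cancels the Jacobian, leaving the polynomials to which the algebraic
  -- duality applies.
  have hR' : ∀ B : ZonotopalAlgebra.ListBasis r X,
      |s.det B.vec| • R B = ZonotopalAlgebra.ListBasis.dualPoly s B := fun B => by
    rw [(ZonotopalAlgebra.isBasisDistr_polyDistr_iff s (R B)).1 (hR B), smul_smul,
      mul_inv_cancel₀ (abs_ne_zero.2 (B.det_vec_ne_zero s)), one_smul]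
  simp_rw [hR']
  refine ⟨⟨ZonotopalAlgebra.linearIndependent_dualPoly s,
    ZonotopalAlgebra.span_dualPoly s hX⟩,
    ⟨ZonotopalAlgebra.linearIndependent_polyQ s,
      ZonotopalAlgebra.span_polyQ s⟩, fun B D => ?_⟩
  rw [ZonotopalAlgebra.ListBasis.pairing_eq_ite]
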